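/- Let $U\subset\mathbb R^4$ be open, with coordinates $(x,y,z,t)$; subscripts denote partial derivatives, all functions are real and $C^\infty$ on $U$, and $dx^i\,dx^j=\tfrac12(dx^i\otimes dx^j+dx^j\otimes dx^i)$. A pseudo-Riemannian metric $g$ on $U$ is called self-dual with respect to an orientation if its Weyl tensor satisfies $\star W=W$, where $\star$ is the Hodge star of $g$ and the orientation acting on the first pair of indices of $W$; this depends only on the conformal class of $g$. We orient $U$ by declaring a given nowhere vanishing 4-form to be positive. **Theorem.** (1) Let $a,b,c,d,q,r$ satisfy $ad-bc\neq0$ everywhere on $U$ and solve the system $$a\,c_t+b\,c_z-c\,a_t-d\,a_z=0,\qquad a\,d_t+b\,d_z-c\,b_t-d\,b_z=0,$$ $$aq\,(dr)_t-cr\,(bq)_t+bq\,(dr)_z-dr\,(bq)_z+(dr)_x-(bq)_y=0,$$ $$aq\,(cr)_t-cr\,(aq)_t+bq\,(cr)_z-dr\,(aq)_z+(cr)_x-(aq)_y=0,$$ $$ac\,(r-q)_t+(q+r)(a\,c_t+b\,c_z-c\,a_t-d\,a_z)-ad\,q_z+bc\,r_z-a_y+c_x=0,$$ $$ad\,r_t-bc\,q_t+(q+r)(a\,d_t-c\,b_t+b\,d_z-d\,b_z)+bd\,(r-q)_z-b_y+d_x=0$$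 (which is the commutativity condition $[X,Y]=0$ for all $\lambda$ of the Lax pair $X=\partial_x+(\lambda+q)(a\partial_t+b\partial_z)$, $Y=\partial_y+(\lambda+r)(c\partial_t+d\partial_z)$, written out in the coefficients of $\lambda$). Then $$g=b\,dt\,dx+d\,dt\,dy-(q-r)(ad-bc)\,dx\,dy-a\,dx\,dz-c\,dy\,dz$$ is a pseudo-Riemannian metric on $U$ that is self-dual with respect to the orientation given by $(ad-bc)\,dx\wedge dy\wedge dz\wedge dt$. (2) Let $u,v,w$ solve the system $$u_{xz}+u_{ty}+v_y\,u_{xx}-(v_x+w_y)\,u_{xy}+w_x\,u_{yy}=0,$$ $$v_{xz}+v_{ty}+v_y\,v_{xx}-(v_x+w_y)\,v_{xy}+w_x\,v_{yy}+u_y=0,$$ $$w_{xz}+w_{ty}+v_y\,w_{xx}-(v_x+w_y)\,w_{xy}+w_x\,w_{yy}+u_x=0$$ on $U$. Then $$g=dt\,dy+dx\,dz-w_x\,dt^2+(v_x+w_y)\,dt\,dz-v_y\,dz^2$$ is a pseudo-Riemannian metric on $U$ that is self-dual with respect to the orientation given by $-dx\wedge dy\wedge dz\wedge dt$. (3) Let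 $u,v,w$ satisfy $v_xw_y-v_yw_x\neq0$ everywhere on $U$ and solve the system $$w_x\,u_{yz}-v_y\,u_{tx}+v_x\,u_{ty}-w_y\,u_{xz}=0,$$ $$w_x\,v_{yz}-v_y\,v_{tx}+v_x\,v_{ty}-w_y\,v_{xz}-v_y\,u_x+v_x\,u_y=0,$$ $$w_x\,w_{yz}-v_y\,w_{tx}+v_x\,w_{ty}-w_y\,w_{xz}-w_y\,u_x+w_x\,u_y=0$$ on $U$. Then $$g=w_x\,dt\,dx+w_y\,dt\,dy-v_x\,dx\,dz-v_y\,dy\,dz$$ is a pseudo-Riemannian metric on $U$ that is self-dual with respect to the orientation given by $(v_xw_y-v_yw_x)\,dx\wedge dy\wedge dz\wedge dt$. -/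

import Mathlib

open scoped ContDiff

noncomputable section

namespace SelfDual4D

/-- Coordinate space with coordinates `(x, y, z, t) = (p 0, p 1, p 2, p 3)`. -/
abbrev R4 : Type := Fin 4 → ℝ

/-- The partial derivative `∂f/∂xⁱ`. -/
def pd (i : Fin 4) (f : R4 → ℝ) : R4 → ℝ := fun p => fderiv ℝ f p (Pi.single i 1)

abbrev pdx (f : R4 → ℝ) : R4 → ℝ := pd 0 f
abbrev pdy (f : R4 → ℝ) : R4 → ℝ := pd 1 f
abbrev pdz (f : R4 → ℝ) : R4 → ℝ := pd 2 f
abbrev pdt (f : R4 → ℝ) : R4 → ℝ := pd 3 f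

/-! ### Curvature of a metric in coordinates and self-duality -/

/-- A field of bilinear forms `g = ∑ g_{ij} dxⁱ ⊗ dxʲ`. -/
abbrev MetricField : Type := R4 → Matrix (Fin 4) (Fin 4) ℝ

/-- Christoffel symbols `Γᵏ_{ij}` of the Levi-Civita connection. -/
def christoffel (g : MetricField) (k i j : Fin 4) : R4 → ℝ := fun p =>
  (1 / 2) * ∑ l, (g p)⁻¹ k l *
    (pd i (fun p' => g p' j l) p + pd j (fun p' => g p' i l) p - pd l (fun p' => g p' i j) p)

/-- `Rˡ_{kij}`, that is `R(∂ᵢ, ∂ⱼ) ∂ₖ = ∑ₗ Rˡ_{kij} ∂ₗ` for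
`R(X, Y) = ∇_X ∇_Y - ∇_Y ∇_X - ∇_{[X,Y]}`. -/
def riemannUp (g : MetricField) (l k i j : Fin 4) : R4 → ℝ := fun p =>
  pd i (christoffel g l j k) p - pd j (christoffel g l i k) p
    + ∑ m, (christoffel g l i m p * christoffel g m j k p
        - christoffel g l j m p * christoffel g m i k p)

/-- `R_{lkij} = ∑ₘ g_{lm} Rᵐ_{kij}`. -/
def riemann (g : MetricField) (l k i j : Fin 4) : R4 → ℝ := fun p =>
  ∑ m, g p l m * riemannUp g m k i j p

/-- Ricci tensor `Ric_{kj} = ∑ᵢ Rⁱ_{kij}`. -/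
def ricci (g : MetricField) (k j : Fin 4) : R4 → ℝ := fun p =>
  ∑ i, riemannUp g i k i j p

/-- Scalar curvature. -/
def scalarCurv (g : MetricField) : R4 → ℝ := fun p =>
  ∑ i, ∑ j, (g p)⁻¹ i j * ricci g i j p

/-- The Weyl tensor `W_{lkij}` in dimension four. -/
def weyl (g : MetricField) (l k i j : Fin 4) : R4 → ℝ := fun p =>
  riemann g l k i j p
    - (1 / 2) * (g p l i * ricci g k j p - g p l j * ricci g k i p
        - g p k i * ricci g l j p + g p k j * ricci g l i p)
    + (scalarCurv g p / 6) * (g p l i * g p k j - g p l j * g p k i)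

/-- The Levi-Civita symbol, the value of `dx ∧ dy ∧ dz ∧ dt` on `(∂ᵢ, ∂ⱼ, ∂ₖ, ∂ₗ)`. -/
def leviCivita (i j k l : Fin 4) : ℤ :=
  (Matrix.of fun a b : Fin 4 => if ![i, j, k, l] a = b then (1 : ℤ) else 0).det

/-- The components of the volume form of `g` for the orientation in which the 4-form
`η dx ∧ dy ∧ dz ∧ dt` (with `η` nowhere zero) is positive. -/
def volForm (g : MetricField) (η : R4 → ℝ) (i j k l : Fin 4) : R4 → ℝ := fun p =>
  Real.sign (η p) * Real.sqrt |(g p).det| * (leviCivita i j k l : ℝ)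

/-- The Hodge star on 2-forms `α = (α_{ij})` at the point `p`:
`(⋆α)_{ij} = ½ ∑ vol_{ijkl} g^{km} g^{ln} α_{mn}`. -/
def hodgeStar (g : MetricField) (η : R4 → ℝ) (p : R4) (α : Fin 4 → Fin 4 → ℝ)
    (i j : Fin 4) : ℝ :=
  (1 / 2) * ∑ k, ∑ l, ∑ m, ∑ n,
    volForm g η i j k l p * (g p)⁻¹ k m * (g p)⁻¹ l n * α m n

/-- On `U`, `g` is a smooth pseudo-Riemannian metric, `η dx ∧ dy ∧ dz ∧ dt` defines an orientation,
and the Weyl tensor of `g` is self-dual for this orientation: `⋆W = W` (that is, `W⁻ = 0`). -/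
structure IsSelfDualOn (g : MetricField) (η : R4 → ℝ) (U : Set R4) : Prop where
  smooth : ∀ i j, ContDiffOn ℝ ∞ (fun p => g p i j) U
  symm : ∀ p ∈ U, (g p).IsSymm
  nondegenerate : ∀ p ∈ U, (g p).det ≠ 0
  orientation_continuous : ContinuousOn η U
  orientation_ne_zero : ∀ p ∈ U, η p ≠ 0
  selfDual : ∀ p ∈ U, ∀ i j k l,
    hodgeStar g η p (fun m n => weyl g m n k l p) i j = weyl g i j k l p

/-! ### The metrics -/

/-- The symmetric product `dxⁱ dxʲ = ½ (dxⁱ ⊗ dxʲ + dxʲ ⊗ dxⁱ)`. -/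
def symProd (i j : Fin 4) : Matrix (Fin 4) (Fin 4) ℝ :=
  (1 / 2 : ℝ) • (Matrix.single i j 1 + Matrix.single j i 1)

abbrev dxdy : Matrix (Fin 4) (Fin 4) ℝ := symProd 0 1
abbrev dxdz : Matrix (Fin 4) (Fin 4) ℝ := symProd 0 2
abbrev dydz : Matrix (Fin 4) (Fin 4) ℝ := symProd 1 2
abbrev dtdx : Matrix (Fin 4) (Fin 4) ℝ := symProd 3 0
abbrev dtdy : Matrix (Fin 4) (Fin 4) ℝ := symProd 3 1
abbrev dtdz : Matrix (Fin 4) (Fin 4) ℝ := symProd 3 2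
abbrev dtdt : Matrix (Fin 4) (Fin 4) ℝ := symProd 3 3
abbrev dzdz : Matrix (Fin 4) (Fin 4) ℝ := symProd 2 2

/-- `g = b dt dx + d dt dy - (q - r)(ad - bc) dx dy - a dx dz - c dy dz`. -/
def metricSix (a b c d q r : R4 → ℝ) : MetricField := fun p =>
  b p • dtdx + d p • dtdy - ((q p - r p) * (a p * d p - b p * c p)) • dxdy
    - a p • dxdz - c p • dydz

/-- `g = dt dy + dx dz - w_x dt² + (v_x + w_y) dt dz - v_y dz²`. -/
def metricSecond (v w : R4 → ℝ) : MetricField := fun p =>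
  dtdy + dxdz - pdx w p • dtdt + (pdx v p + pdy w p) • dtdz - pdy v p • dzdz

/-- `g = w_x dt dx + w_y dt dy - v_x dx dz - v_y dy dz`. -/
def metricFirst (v w : R4 → ℝ) : MetricField := fun p =>
  pdx w p • dtdx + pdy w p • dtdy - pdx v p • dxdz - pdy v p • dydz

/-! ### The systems of partial differential equations -/

/-- The system of six equations on six unknowns that expresses `[X, Y] = 0` (for all `λ`) for
`X = ∂_x + (λ + q)(a ∂_t + b ∂_z)`, `Y = ∂_y + (λ + r)(c ∂_t + d ∂_z)`. -/
structure SolvesSix (a b c d q r : R4 → ℝ) (U : Set R4) : Prop where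
  eq1 : ∀ p ∈ U, (a * pdt c + b * pdz c - c * pdt a - d * pdz a) p = 0
  eq2 : ∀ p ∈ U, (a * pdt d + b * pdz d - c * pdt b - d * pdz b) p = 0
  eq3 : ∀ p ∈ U, (a * q * pdt (d * r) - c * r * pdt (b * q) + b * q * pdz (d * r)
    - d * r * pdz (b * q) + pdx (d * r) - pdy (b * q)) p = 0
  eq4 : ∀ p ∈ U, (a * q * pdt (c * r) - c * r * pdt (a * q) + b * q * pdz (c * r)
    - d * r * pdz (a * q) + pdx (c * r) - pdy (a * q)) p = 0
  eq5 : ∀ p ∈ U, (a * c * pdt (r - q)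
    + (q + r) * (a * pdt c + b * pdz c - c * pdt a - d * pdz a)
    - a * d * pdz q + b * c * pdz r - pdy a + pdx c) p = 0
  eq6 : ∀ p ∈ U, (a * d * pdt r - b * c * pdt q
    + (q + r) * (a * pdt d - c * pdt b + b * pdz d - d * pdz b)
    + b * d * pdz (r - q) - pdy b + pdx d) p = 0

/-- The three-component generalization of the second heavenly equation. -/
structure SolvesSecond (u v w : R4 → ℝ) (U : Set R4) : Prop where
  eq1 : ∀ p ∈ U, (pdz (pdx u) + pdy (pdt u) + pdy v * pdx (pdx u)
    - (pdx v + pdy w) * pdy (pdx u) + pdx w * pdy (pdy u)) p = 0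
  eq2 : ∀ p ∈ U, (pdz (pdx v) + pdy (pdt v) + pdy v * pdx (pdx v)
    - (pdx v + pdy w) * pdy (pdx v) + pdx w * pdy (pdy v) + pdy u) p = 0
  eq3 : ∀ p ∈ U, (pdz (pdx w) + pdy (pdt w) + pdy v * pdx (pdx w)
    - (pdx v + pdy w) * pdy (pdx w) + pdx w * pdy (pdy w) + pdx u) p = 0

/-- The three-component generalization of the first heavenly equation. -/
structure SolvesFirst (u v w : R4 → ℝ) (U : Set R4) : Prop where
  eq1 : ∀ p ∈ U, (pdx w * pdz (pdy u) - pdy v * pdx (pdt u) + pdx v * pdy (pdt u)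
    - pdy w * pdz (pdx u)) p = 0
  eq2 : ∀ p ∈ U, (pdx w * pdz (pdy v) - pdy v * pdx (pdt v) + pdx v * pdy (pdt v)
    - pdy w * pdz (pdx v) - pdy v * pdx u + pdx v * pdy u) p = 0
  eq3 : ∀ p ∈ U, (pdx w * pdz (pdy w) - pdy v * pdx (pdt w) + pdx v * pdy (pdt w)
    - pdy w * pdz (pdx w) - pdy w * pdx u + pdx w * pdy u) p = 0

end SelfDual4D

end

open scoped ContDiff

noncomputable section

namespace SelfDual4D

/-! ### Partial derivatives of smooth functions on an open set -/

section Calculus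

variable {U : Set R4} {f f' : R4 → ℝ} {p : R4}

/-! Each system is the compatibility condition of a Lax pair, and the Lax pair supplies a null frame
of the metric. In such a frame `E` the only nonzero products are `g(E₀, E₃) = s` and `g(E₁, E₂) =
-s`, so the planes spanned by `X = E₀ + λ E₁` and `Y = E₂ + λ E₃` are totally null. A two-form is
self-dual, for the orientation of the frame, exactly when it vanishes on all `X ∧ Y`;
`hodgeStar_eq_self` proves the direction needed. Correspondingly the anti-self-dual Weyl curvature
is the quartic polynomial `R(X, Y, X, Y)` in `λ`: its five coefficients are the trace-free part of a
symmetric form on a three-dimensional space of bivectors (`frameWeyl_eq_zero`). It therefore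
suffices that this quartic vanish for every real `λ` at every point (`hodgeStar_weyl_eq`).

The quartic vanishes at `(p, λ)` because a null surface tangent to the plane at `p` would be totally
geodesic. No such surface is constructed. `curv_null_plane` needs only null fields `X`, `Y` near `p`
whose bracket vanishes at `p` together with its derivatives along `X` and `Y`. These come from
replacing `λ` by a function `L` with `L p = λ` that solves `X L = f₀ + L f₁`, `Y L = h₀ + L h₁` to
first order at `p`. Commutation of the lifts `X + (f₀ + λ f₁) ∂_λ` and `Y + (h₀ + λ h₁) ∂_λ` is the
integrability condition of this system, so a quadratic polynomial can serve as `L`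
(`IsLaxFrame.curv_eq_zero`).

What is left for each family is to exhibit the frame and the lift and to match the equations with
the bracket and lift conditions: `isLaxFrame_six`, `isLaxFrame_second`, `isLaxFrame_first`. -/

theorem differentiableAt_of_contDiffOn (hU : IsOpen U) (hf : ContDiffOn ℝ ∞ f U) (hp : p ∈ U) :
    DifferentiableAt ℝ f p :=
  (hf.contDiffAt (hU.mem_nhds hp)).differentiableAt (by simp)

theorem contDiffOn_pd (hU : IsOpen U) (hf : ContDiffOn ℝ ∞ f U) (i : Fin 4) :
    ContDiffOn ℝ ∞ (pd i f) U :=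
  (hf.fderiv_of_isOpen hU (m := ∞) (by simp)).clm_apply contDiffOn_const

theorem pd_congr (hU : IsOpen U) (h : ∀ x ∈ U, f x = f' x) (hp : p ∈ U) (i : Fin 4) :
    pd i f p = pd i f' p := by
  have : f =ᶠ[nhds p] f' := by
    filter_upwards [hU.mem_nhds hp] with x hx using h x hx
  unfold pd
  rw [this.fderiv_eq]

theorem pd_add (hf : DifferentiableAt ℝ f p) (hf' : DifferentiableAt ℝ f' p) (i : Fin 4) :
    pd i (fun x => f x + f' x) p = pd i f p + pd i f' p := by
  unfold pd
  rw [fderiv_fun_add hf hf']; rfl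

theorem pd_sub (hf : DifferentiableAt ℝ f p) (hf' : DifferentiableAt ℝ f' p) (i : Fin 4) :
    pd i (fun x => f x - f' x) p = pd i f p - pd i f' p := by
  unfold pd
  rw [fderiv_fun_sub hf hf']; rfl

theorem pd_neg (i : Fin 4) : pd i (fun x => - f x) p = - pd i f p := by
  unfold pd
  rw [fderiv_fun_neg]; rfl

theorem pd_mul (hf : DifferentiableAt ℝ f p) (hf' : DifferentiableAt ℝ f' p) (i : Fin 4) :
    pd i (fun x => f x * f' x) p = pd i f p * f' p + f p * pd i f' p := by
  unfold pd
  rw [fderiv_fun_mul hf hf']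
  simp; ring

theorem pd_const (c : ℝ) (i : Fin 4) : pd i (fun _ => c) p = 0 := by
  simp [pd]

theorem pd_sum {ι : Type*} {s : Finset ι} {F : ι → R4 → ℝ}
    (hF : ∀ k ∈ s, DifferentiableAt ℝ (F k) p) (i : Fin 4) :
    pd i (fun x => ∑ k ∈ s, F k x) p = ∑ k ∈ s, pd i (F k) p := by
  unfold pd
  rw [fderiv_fun_sum hF]
  simp

theorem pd_coord (i j : Fin 4) : pd i (fun x => x j) p = if i = j then 1 else 0 := by
  unfold pd
  rw [fderiv_apply differentiableAt_id]
  simp [Pi.single_apply, eq_comm]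

theorem pd_comm (hU : IsOpen U) (hf : ContDiffOn ℝ ∞ f U) (hp : p ∈ U) (i j : Fin 4) :
    pd i (pd j f) p = pd j (pd i f) p := by
  have hs : IsSymmSndFDerivAt ℝ f p :=
    (hf.contDiffAt (hU.mem_nhds hp)).isSymmSndFDerivAt (by
      simp only [minSmoothness_of_isRCLikeNormedField]
      exact WithTop.coe_le_coe.2 (le_top (a := (2 : ℕ∞))))
  have hd : DifferentiableAt ℝ (fderiv ℝ f) p :=
    ((hf.fderiv_of_isOpen hU (m := ∞) (by simp)).contDiffAt (hU.mem_nhds hp)).differentiableAt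
      (by simp)
  have key : ∀ i j, pd i (pd j f) p
      = fderiv ℝ (fderiv ℝ f) p (Pi.single i 1) (Pi.single j 1) := by
    intro i j
    unfold pd
    rw [fderiv_clm_apply hd (differentiableAt_const _)]
    simp
  rw [key, key]
  exact hs _ _

end Calculus

/-! ### Vector fields, the Levi-Civita connection and its curvature -/

/-- A vector field `∑ Vⁱ ∂ᵢ`, given by its components. -/
abbrev VField : Type := Fin 4 → R4 → ℝ

/-- The derivative of `f` along `X`. -/
def dir (X : VField) (f : R4 → ℝ) : R4 → ℝ := fun p => ∑ i, X i p * pd i f p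

/-- The function `g(A, B)`. -/
def bil (g : MetricField) (A B : VField) : R4 → ℝ := fun p =>
  ∑ i, ∑ j, g p i j * A i p * B j p

/-- The covariant derivative `∇_{∂ᵢ} A`. -/
def nabla (g : MetricField) (i : Fin 4) (A : VField) : VField := fun k p =>
  pd i (A k) p + ∑ j, christoffel g k i j p * A j p

/-- The covariant derivative `∇_X A`. -/
def cov (g : MetricField) (X A : VField) : VField := fun k p =>
  ∑ i, X i p * nabla g i A k p

/-- The Lie bracket `[X, Y]`. -/
def lie (X Y : VField) : VField := fun k p => dir X (Y k) p - dir Y (X k) p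

/-- A smooth pseudo-Riemannian metric on `U`. -/
structure IsMetricOn (g : MetricField) (U : Set R4) : Prop where
  smooth : ∀ i j, ContDiffOn ℝ ∞ (fun p => g p i j) U
  symm : ∀ p ∈ U, (g p).IsSymm
  nondegenerate : ∀ p ∈ U, (g p).det ≠ 0

/-! ### Christoffel symbols of a smooth metric. -/

namespace IsMetricOn

variable {g : MetricField} {U : Set R4} (hg : IsMetricOn g U) (hU : IsOpen U)
include hg

theorem comm {p : R4} (hp : p ∈ U) (i j : Fin 4) : g p i j = g p j i :=
  (hg.symm p hp).apply j i

theorem bil_comm {p : R4} (hp : p ∈ U) (A B : VField) : bil g A B p = bil g B A p := by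
  unfold bil
  rw [Finset.sum_comm]
  refine Finset.sum_congr rfl fun i _ => Finset.sum_congr rfl fun j _ => ?_
  rw [hg.comm hp]; ring

theorem contDiffOn_det : ContDiffOn ℝ ∞ (fun p => (g p).det) U := by
  simp only [Matrix.det_apply']
  exact ContDiffOn.sum fun σ _ => contDiffOn_const.mul
    (contDiffOn_prod fun i _ => hg.smooth _ _)

theorem contDiffOn_inv (i j : Fin 4) : ContDiffOn ℝ ∞ (fun p => (g p)⁻¹ i j) U := by
  -- The inverse is the adjugate, polynomial in the entries, divided by the nonvanishing
  -- determinant.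
  have h1 : ContDiffOn ℝ ∞ (fun p => (g p).adjugate i j) U := by
    simp only [Matrix.adjugate_apply, Matrix.det_apply']
    refine ContDiffOn.sum fun σ _ => contDiffOn_const.mul (contDiffOn_prod fun k _ => ?_)
    simp only [Matrix.updateRow_apply]
    split_ifs
    · exact contDiffOn_const
    · exact hg.smooth _ _
  refine ((hg.contDiffOn_det.inv hg.nondegenerate).mul h1).congr fun p _ => ?_
  simp [Matrix.inv_def, Ring.inverse_eq_inv']

theorem contDiffOn_pd_entry (hU : IsOpen U) (i j k : Fin 4) :
    ContDiffOn ℝ ∞ (pd i (fun p => g p j k)) U := contDiffOn_pd hU (hg.smooth j k) i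

theorem contDiffOn_christoffel (hU : IsOpen U) (k i j : Fin 4) :
    ContDiffOn ℝ ∞ (christoffel g k i j) U :=
  contDiffOn_const.mul (ContDiffOn.sum fun l _ => (hg.contDiffOn_inv k l).mul
    (((hg.contDiffOn_pd_entry hU i j l).add (hg.contDiffOn_pd_entry hU j i l)).sub
      (hg.contDiffOn_pd_entry hU l i j)))

theorem mul_inv {p : R4} (hp : p ∈ U) : g p * (g p)⁻¹ = 1 :=
  Matrix.mul_nonsing_inv _ (isUnit_iff_ne_zero.2 (hg.nondegenerate p hp))

theorem pd_entry_comm (hU : IsOpen U) {p : R4} (hp : p ∈ U) (i j k : Fin 4) :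
    pd i (fun x => g x j k) p = pd i (fun x => g x k j) p :=
  pd_congr hU (fun _ hx => hg.comm hx j k) hp i

theorem christoffel_comm (hU : IsOpen U) {p : R4} (hp : p ∈ U) (k i j : Fin 4) :
    christoffel g k i j p = christoffel g k j i p := by
  unfold christoffel
  congr 1
  refine Finset.sum_congr rfl fun l _ => ?_
  rw [hg.pd_entry_comm hU hp l i j]; ring

theorem lower_christoffel {p : R4} (hp : p ∈ U) (l i j : Fin 4) :
    ∑ m, g p l m * christoffel g m i j p
      = (1 / 2) * (pd i (fun x => g x j l) p + pd j (fun x => g x i l) p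
          - pd l (fun x => g x i j) p) := by
  have h := hg.mul_inv hp
  have : (g p).mulVec ((g p)⁻¹.mulVec fun l => (1 / 2) * (pd i (fun x => g x j l) p
      + pd j (fun x => g x i l) p - pd l (fun x => g x i j) p)) = fun l => (1 / 2) *
      (pd i (fun x => g x j l) p + pd j (fun x => g x i l) p - pd l (fun x => g x i j) p) := by
    rw [Matrix.mulVec_mulVec, h, Matrix.one_mulVec]
  have := congrFun this l
  rw [← this]
  simp only [Matrix.mulVec, dotProduct, christoffel]
  refine Finset.sum_congr rfl fun m _ => ?_
  rw [Finset.mul_sum]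
  congr 1
  exact Finset.sum_congr rfl fun n _ => by ring

/-- This is `∇g = 0` in coordinates: in the sum of the two lowered Christoffel symbols all other
derivatives of the metric cancel. -/
theorem pd_entry (hU : IsOpen U) {p : R4} (hp : p ∈ U) (i j k : Fin 4) :
    pd i (fun x => g x j k) p
      = ∑ m, g p m k * christoffel g m i j p + ∑ m, g p j m * christoffel g m i k p := by
  simp only [fun m => hg.comm hp m k]
  rw [hg.lower_christoffel hp, hg.lower_christoffel hp, hg.pd_entry_comm hU hp i k j,
    hg.pd_entry_comm hU hp j i k, hg.pd_entry_comm hU hp k i j]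
  ring

end IsMetricOn

/-- The vector field is smooth on `U`. -/
def VField.SmoothOn (A : VField) (U : Set R4) : Prop := ∀ i, ContDiffOn ℝ ∞ (A i) U

section Smoothness

variable {U : Set R4} {X Y : VField} {f : R4 → ℝ}

theorem contDiffOn_dir (hU : IsOpen U) (hX : X.SmoothOn U) (hf : ContDiffOn ℝ ∞ f U) :
    ContDiffOn ℝ ∞ (dir X f) U :=
  ContDiffOn.sum fun i _ => (hX i).mul (contDiffOn_pd hU hf i)

theorem smoothOn_lie (hU : IsOpen U) (hX : X.SmoothOn U) (hY : Y.SmoothOn U) :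
    (lie X Y).SmoothOn U := fun k =>
  (contDiffOn_dir hU hX (hY k)).sub (contDiffOn_dir hU hY (hX k))

end Smoothness

/-! ### The covariant derivative on vector fields. -/

namespace IsMetricOn

variable {g : MetricField} {U : Set R4} (hg : IsMetricOn g U) (hU : IsOpen U)
include hg hU

omit hU in
theorem contDiffOn_bil {A B : VField} (hA : A.SmoothOn U) (hB : B.SmoothOn U) :
    ContDiffOn ℝ ∞ (bil g A B) U :=
  ContDiffOn.sum fun i _ => ContDiffOn.sum fun j _ => ((hg.smooth i j).mul (hA i)).mul (hB j)

theorem smoothOn_nabla {A : VField} (hA : A.SmoothOn U) (i : Fin 4) :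
    (nabla g i A).SmoothOn U := fun k =>
  (contDiffOn_pd hU (hA k) i).add (ContDiffOn.sum fun j _ =>
    (hg.contDiffOn_christoffel hU k i j).mul (hA j))

theorem smoothOn_cov {X A : VField} (hX : X.SmoothOn U) (hA : A.SmoothOn U) :
    (cov g X A).SmoothOn U := fun k =>
  ContDiffOn.sum fun i _ => (hX i).mul (hg.smoothOn_nabla hU hA i k)

/-- The Levi-Civita connection is metric. -/
theorem pd_bil {A B : VField} (hA : A.SmoothOn U) (hB : B.SmoothOn U) {p : R4} (hp : p ∈ U)
    (i : Fin 4) :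
    pd i (bil g A B) p = bil g (nabla g i A) B p + bil g A (nabla g i B) p := by
  have dA := fun j => differentiableAt_of_contDiffOn hU (hA j) hp
  have dB := fun j => differentiableAt_of_contDiffOn hU (hB j) hp
  have dg := fun j k => differentiableAt_of_contDiffOn hU (hg.smooth j k) hp
  have h : ∀ j k, pd i (fun x => g x j k * A j x * B k x) p
      = (∑ m, g p m k * christoffel g m i j p + ∑ m, g p j m * christoffel g m i k p)
          * A j p * B k p + g p j k * pd i (A j) p * B k p + g p j k * A j p * pd i (B k) p := by
    intro j k
    rw [pd_mul ((dg j k).fun_mul (dA j)) (dB k), pd_mul (dg j k) (dA j), hg.pd_entry hU hp]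
    ring
  unfold bil
  rw [pd_sum fun j _ => DifferentiableAt.fun_sum fun k _ => ((dg j k).fun_mul (dA j)).fun_mul (dB k)]
  simp only [pd_sum fun k _ => ((dg _ k).fun_mul (dA _)).fun_mul (dB k), h, nabla]
  simp only [Fin.sum_univ_four]
  ring

theorem dir_bil {X A B : VField} (hA : A.SmoothOn U) (hB : B.SmoothOn U) {p : R4} (hp : p ∈ U) :
    dir X (bil g A B) p = bil g (cov g X A) B p + bil g A (cov g X B) p := by
  simp only [dir, hg.pd_bil hU hA hB hp, bil, cov]
  simp only [Fin.sum_univ_four]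
  ring

/-- The Levi-Civita connection is torsion-free. -/
theorem cov_sub_cov (X Y : VField) {p : R4} (hp : p ∈ U) (k : Fin 4) :
    cov g X Y k p - cov g Y X k p = lie X Y k p := by
  have h : ∑ i, ∑ j, X i p * (christoffel g k i j p * Y j p)
      = ∑ i, ∑ j, Y i p * (christoffel g k i j p * X j p) := by
    rw [Finset.sum_comm]
    refine Finset.sum_congr rfl fun i _ => Finset.sum_congr rfl fun j _ => ?_
    rw [hg.christoffel_comm hU hp]; ring
  simp only [cov, nabla, lie, dir, mul_add, Finset.sum_add_distrib, Finset.mul_sum]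
  rw [h]; ring

/-- The Ricci identity in coordinates. -/
theorem nabla_nabla {A : VField} (hA : A.SmoothOn U) {p : R4} (hp : p ∈ U) (i j k : Fin 4) :
    nabla g i (nabla g j A) k p - nabla g j (nabla g i A) k p
      = ∑ m, riemannUp g k m i j p * A m p := by
  have dA := fun j => differentiableAt_of_contDiffOn hU (hA j) hp
  have dpA := fun i j => differentiableAt_of_contDiffOn hU (contDiffOn_pd hU (hA j) i) hp
  have dG := fun k i j => differentiableAt_of_contDiffOn hU (hg.contDiffOn_christoffel hU k i j) hp
  have h : ∀ i j, pd i (nabla g j A k) p = pd i (pd j (A k)) p + ∑ m,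
      (pd i (christoffel g k j m) p * A m p + christoffel g k j m p * pd i (A m) p) := by
    intro i j
    unfold nabla
    rw [pd_add (dpA j k) (DifferentiableAt.fun_sum fun m _ => (dG k j m).fun_mul (dA m)),
      pd_sum fun m _ => (dG k j m).fun_mul (dA m)]
    simp only [pd_mul (dG k j _) (dA _)]
  have e : ∀ i j, nabla g i (nabla g j A) k p = pd i (nabla g j A k) p
      + ∑ n, christoffel g k i n p * (pd j (A n) p + ∑ m, christoffel g n j m p * A m p) :=
    fun i j => rfl
  rw [e, e, h, h, pd_comm hU (hA k) hp i j]
  simp only [riemannUp, Fin.sum_univ_four]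
  ring

end IsMetricOn

/-- The curvature `g(A, R(C, D) B)` of vectors at the point `p`. -/
def curv (g : MetricField) (p : R4) (A B C D : Fin 4 → ℝ) : ℝ :=
  ∑ l, ∑ k, ∑ i, ∑ j, riemann g l k i j p * A l * B k * C i * D j

theorem pd_eq_zero {U : Set R4} (hU : IsOpen U) {f : R4 → ℝ} (h : ∀ x ∈ U, f x = 0) {p : R4}
    (hp : p ∈ U) (i : Fin 4) : pd i f p = 0 := by
  rw [pd_congr hU h hp, pd_const]

theorem dir_eq_zero {U : Set R4} (hU : IsOpen U) {f : R4 → ℝ} (h : ∀ x ∈ U, f x = 0) {p : R4}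
    (hp : p ∈ U) (X : VField) : dir X f p = 0 := by
  simp [dir, pd_eq_zero hU h hp]

theorem riemannUp_swap (g : MetricField) (p : R4) (l k i j : Fin 4) :
    riemannUp g l k i j p = - riemannUp g l k j i p := by
  simp only [riemannUp, Finset.sum_sub_distrib]
  ring

theorem riemann_swap_right (g : MetricField) (p : R4) (l k i j : Fin 4) :
    riemann g l k i j p = - riemann g l k j i p := by
  simp only [riemann, riemannUp_swap g p _ k i j, mul_neg, Finset.sum_neg_distrib]

/-! ### Curvature on vector fields, null planes, and curvature symmetries. -/

namespace IsMetricOn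

variable {g : MetricField} {U : Set R4} (hg : IsMetricOn g U) (hU : IsOpen U)
include hg hU

theorem nabla_cov {Y A : VField} (hY : Y.SmoothOn U) (hA : A.SmoothOn U) {p : R4} (hp : p ∈ U)
    (i k : Fin 4) :
    nabla g i (cov g Y A) k p = ∑ j, (pd i (Y j) p * nabla g j A k p
      + Y j p * nabla g i (nabla g j A) k p) := by
  have dY := fun j => differentiableAt_of_contDiffOn hU (hY j) hp
  have dN := fun j k => differentiableAt_of_contDiffOn hU (hg.smoothOn_nabla hU hA j k) hp
  have h : pd i (cov g Y A k) p
      = ∑ j, (pd i (Y j) p * nabla g j A k p + Y j p * pd i (nabla g j A k) p) := by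
    unfold cov
    rw [pd_sum fun j _ => (dY j).fun_mul (dN j k)]
    simp only [pd_mul (dY _) (dN _ _)]
  have e : ∀ B : VField, nabla g i B k p = pd i (B k) p + ∑ j, christoffel g k i j p * B j p :=
    fun _ => rfl
  rw [e (cov g Y A), h]
  simp only [fun j => e (nabla g j A), cov, Fin.sum_univ_four]
  ring

/-- The Ricci identity for vector fields. -/
theorem cov_cov {X Y A : VField} (hX : X.SmoothOn U) (hY : Y.SmoothOn U) (hA : A.SmoothOn U)
    {p : R4} (hp : p ∈ U) (k : Fin 4) :
    cov g X (cov g Y A) k p - cov g Y (cov g X A) k p - cov g (lie X Y) A k p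
      = ∑ m, ∑ i, ∑ j, riemannUp g k m i j p * A m p * X i p * Y j p := by
  have h : ∀ i j, nabla g i (nabla g j A) k p = nabla g j (nabla g i A) k p
      + ∑ m, riemannUp g k m i j p * A m p := fun i j => by
    rw [← hg.nabla_nabla hU hA hp]; ring
  have h1 : ∑ i, ∑ j, X i p * (Y j p * nabla g i (nabla g j A) k p)
      = ∑ i, ∑ j, Y i p * (X j p * nabla g i (nabla g j A) k p)
        + ∑ m, ∑ i, ∑ j, riemannUp g k m i j p * A m p * X i p * Y j p := by
    have h2 : ∑ m, ∑ i, ∑ j, riemannUp g k m i j p * A m p * X i p * Y j p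
        = ∑ j, ∑ i, ∑ m, riemannUp g k m i j p * A m p * X i p * Y j p := by
      rw [Finset.sum_comm]
      simp only [fun i => Finset.sum_comm (s := Finset.univ) (t := Finset.univ)
        (f := fun m j => riemannUp g k m i j p * A m p * X i p * Y j p)]
      rw [Finset.sum_comm]
    rw [h2, Finset.sum_comm, ← Finset.sum_add_distrib]
    refine Finset.sum_congr rfl fun j _ => ?_
    rw [← Finset.sum_add_distrib]
    refine Finset.sum_congr rfl fun i _ => ?_
    rw [h i j, mul_add, mul_add, Finset.mul_sum, Finset.mul_sum]
    congr 1
    · ring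
    · exact Finset.sum_congr rfl fun m _ => by ring
  have e : ∀ X Y : VField, Y.SmoothOn U → cov g X (cov g Y A) k p
      = ∑ i, ∑ j, X i p * (pd i (Y j) p * nabla g j A k p)
        + ∑ i, ∑ j, X i p * (Y j p * nabla g i (nabla g j A) k p) := by
    intro X Y hY
    rw [← Finset.sum_add_distrib]
    refine Finset.sum_congr rfl fun i _ => ?_
    rw [hg.nabla_cov hU hY hA hp, ← Finset.sum_add_distrib, Finset.mul_sum]
    exact Finset.sum_congr rfl fun j _ => by ring
  have e' : cov g (lie X Y) A k p = ∑ i, ∑ j, X i p * (pd i (Y j) p * nabla g j A k p)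
      - ∑ i, ∑ j, Y i p * (pd i (X j) p * nabla g j A k p) := by
    simp only [fun X Y : VField => Finset.sum_comm (s := Finset.univ) (t := Finset.univ)
      (f := fun i j => X i p * (pd i (Y j) p * nabla g j A k p))]
    rw [← Finset.sum_sub_distrib]
    refine Finset.sum_congr rfl fun j _ => ?_
    simp only [lie, dir, sub_mul, Finset.sum_mul, mul_assoc]
  rw [e X Y hY, e Y X hX, e', h1]
  ring

theorem curv_eq {X Y A : VField} (B : VField) (hX : X.SmoothOn U) (hY : Y.SmoothOn U)
    (hA : A.SmoothOn U) {p : R4} (hp : p ∈ U) :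
    curv g p (fun i => B i p) (fun i => A i p) (fun i => X i p) (fun i => Y i p)
      = bil g B (cov g X (cov g Y A)) p - bil g B (cov g Y (cov g X A)) p
        - bil g B (cov g (lie X Y) A) p := by
  have h : bil g B (cov g X (cov g Y A)) p - bil g B (cov g Y (cov g X A)) p
        - bil g B (cov g (lie X Y) A) p
      = ∑ l, ∑ n, g p l n * B l p *
        ∑ k, ∑ i, ∑ j, riemannUp g n k i j p * A k p * X i p * Y j p := by
    unfold bil
    simp only [← Finset.sum_sub_distrib, ← hg.cov_cov hU hX hY hA hp]
    exact Finset.sum_congr rfl fun i _ => Finset.sum_congr rfl fun j _ => by ring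
  rw [h]
  unfold curv riemann
  refine Finset.sum_congr rfl fun l _ => ?_
  simp only [Finset.mul_sum, Finset.sum_mul]
  symm
  rw [Finset.sum_comm]
  refine Finset.sum_congr rfl fun k _ => ?_
  rw [Finset.sum_comm]
  refine Finset.sum_congr rfl fun i _ => ?_
  rw [Finset.sum_comm]
  exact Finset.sum_congr rfl fun j _ => Finset.sum_congr rfl fun n _ => by ring

/-- If `X`, `Y` span totally null planes that contain their own orthogonal vectors, and `[X, Y]`
vanishes at `p` together with its derivatives along `X` and `Y`, then `R(X, Y, X, Y) = 0` at `p`. -/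
theorem curv_null_plane {X Y : VField} (hX : X.SmoothOn U) (hY : Y.SmoothOn U)
    (hXX : ∀ x ∈ U, bil g X X x = 0) (hXY : ∀ x ∈ U, bil g X Y x = 0)
    (hYY : ∀ x ∈ U, bil g Y Y x = 0) {p : R4} (hp : p ∈ U)
    (hmax : ∀ A B : VField, bil g A X p = 0 → bil g A Y p = 0 → bil g B X p = 0 →
      bil g B Y p = 0 → bil g A B p = 0)
    (hZ : ∀ k, lie X Y k p = 0) (hZX : ∀ k, dir X (lie X Y k) p = 0)
    (hZY : ∀ k, dir Y (lie X Y k) p = 0) :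
    curv g p (fun i => X i p) (fun i => Y i p) (fun i => X i p) (fun i => Y i p) = 0 := by
  have sZ := smoothOn_lie hU hX hY
  have sXX := hg.smoothOn_cov hU hX hX
  have sXY := hg.smoothOn_cov hU hX hY
  have sYX := hg.smoothOn_cov hU hY hX
  have sYY := hg.smoothOn_cov hU hY hY
  have tors : ∀ A : VField, ∀ x ∈ U,
      bil g A (cov g Y X) x = bil g A (cov g X Y) x - bil g A (lie X Y) x := by
    intro A x hx
    simp only [bil, ← hg.cov_sub_cov hU X Y hx, ← Finset.sum_sub_distrib]
    exact Finset.sum_congr rfl fun i _ => Finset.sum_congr rfl fun j _ => by ring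
  have half : ∀ {V T : VField}, V.SmoothOn U → (∀ x ∈ U, bil g V V x = 0) →
      ∀ x ∈ U, bil g V (cov g T V) x = 0 := by
    intro V T hV h x hx
    have h1 := hg.dir_bil hU (X := T) hV hV hx
    rw [dir_eq_zero hU h hx, hg.bil_comm hx] at h1
    linarith
  have cross : ∀ {T : VField}, ∀ x ∈ U, bil g Y (cov g T X) x = - bil g X (cov g T Y) x := by
    intro T x hx
    have h1 := hg.dir_bil hU (X := T) hX hY hx
    rw [dir_eq_zero hU hXY hx, hg.bil_comm hx] at h1
    linarith
  have hZ0 : ∀ A : VField, bil g A (lie X Y) p = 0 := fun A => by simp [bil, hZ]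
  have hcZ : ∀ T : VField, (∀ k, dir T (lie X Y k) p = 0) → ∀ k, cov g T (lie X Y) k p = 0 := by
    intro T hT k
    have := hT k
    simpa [cov, nabla, hZ, dir] using this
  have dZ : ∀ A T : VField, A.SmoothOn U → (∀ k, dir T (lie X Y k) p = 0) →
      dir T (bil g A (lie X Y)) p = 0 := by
    intro A T hA hT
    rw [hg.dir_bil hU hA sZ hp, hZ0]
    simp [bil, hcZ T hT]
  have e1 : ∀ x ∈ U, bil g X (cov g X Y) x + bil g Y (cov g X X) x = 0 := fun x hx => by
    rw [cross x hx]; ring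
  -- Nullity of the plane and vanishing torsion turn every product of the plane with its own
  -- covariant derivatives into a product with `[X, Y]`. Since `k1` and `k2` hold on all of `U`,
  -- they may be differentiated.
  have k1 : ∀ x ∈ U, bil g X (cov g X Y) x = bil g X (lie X Y) x := fun x hx => by
    have := tors X x hx
    rw [half hX hXX x hx] at this; linarith
  have k2 : ∀ x ∈ U, bil g X (cov g Y Y) x = bil g Y (lie X Y) x := fun x hx => by
    have h1 := tors Y x hx
    rw [half hY hYY x hx, cross x hx] at h1; linarith
  have dcongr : ∀ (T : VField) {f f' : R4 → ℝ}, (∀ x ∈ U, f x = f' x) → dir T f p = dir T f' p :=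
    fun T f f' h => by simp only [dir, pd_congr hU h hp]
  -- At `p` the left sides vanish, because `[X, Y]` vanishes there to first order along `X` and `Y`.
  -- The second derivatives in `R(X, Y)Y` are thus traded for products of first derivatives.
  have h1 := hg.dir_bil hU (X := X) hX sYY hp
  have h2 := hg.dir_bil hU (X := Y) hX sXY hp
  rw [dcongr X k2, dZ Y X hY hZX] at h1
  rw [dcongr Y k1, dZ X Y hX hZY] at h2
  have p1 : bil g X (cov g X Y) p = 0 := by rw [k1 p hp, hZ0]
  have p2 : bil g X (cov g Y Y) p = 0 := by rw [k2 p hp, hZ0]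
  have p3 : bil g Y (cov g X X) p = 0 := by have := e1 p hp; rw [p1] at this; linarith
  have p4 := half (T := X) hX hXX p hp
  have p5 := half (T := X) hY hYY p hp
  have p6 := half (T := Y) hY hYY p hp
  have p7 := half (T := Y) hX hXX p hp
  have p8 : bil g Y (cov g Y X) p = 0 := by rw [tors Y p hp, p5, hZ0]; ring
  have c := fun A B => hg.bil_comm hp A B
  -- All four first derivatives are orthogonal to `X` and `Y` at `p`, so by maximality of the null
  -- plane they are orthogonal to each other.
  have q1 : bil g (cov g X X) (cov g Y Y) p = 0 :=
    hmax _ _ (by rw [c, p4]) (by rw [c, p3]) (by rw [c, p2]) (by rw [c, p6])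
  have q2 : bil g (cov g Y X) (cov g X Y) p = 0 :=
    hmax _ _ (by rw [c, p7]) (by rw [c, p8]) (by rw [c, p1]) (by rw [c, p5])
  rw [hg.curv_eq hU X hX hY hY hp]
  have hl : bil g X (cov g (lie X Y) Y) p = 0 := by simp [bil, cov, hZ]
  rw [hl]
  linarith

/-! ### Symmetries of the curvature tensor -/

theorem riemannUp_bianchi {p : R4} (hp : p ∈ U) (l k i j : Fin 4) :
    riemannUp g l k i j p + riemannUp g l i j k p + riemannUp g l j k i p = 0 := by
  have hc : ∀ k i j, ∀ x ∈ U, christoffel g k i j x = christoffel g k j i x :=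
    fun k i j x hx => hg.christoffel_comm hU hx k i j
  unfold riemannUp
  rw [pd_congr hU (hc l j k) hp i, pd_congr hU (hc l k i) hp j, pd_congr hU (hc l i j) hp k]
  simp only [hc _ j k p hp, hc _ k i p hp, hc _ i j p hp, Finset.sum_sub_distrib]
  ring

theorem riemann_bianchi {p : R4} (hp : p ∈ U) (l k i j : Fin 4) :
    riemann g l k i j p + riemann g l i j k p + riemann g l j k i p = 0 := by
  simp only [riemann, ← Finset.sum_add_distrib, ← mul_add, hg.riemannUp_bianchi hU hp, mul_zero,
    Finset.sum_const_zero]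

/-- Metric compatibility turns the commutator of `∂ᵢ` and `∂ⱼ` acting on `g_{lk}`, which is zero,
into `R_{lkij} + R_{klij}`. -/
theorem riemann_swap_left {p : R4} (hp : p ∈ U) (l k i j : Fin 4) :
    riemann g l k i j p = - riemann g k l i j p := by
  -- The coordinate fields `∂_a`.
  set A : Fin 4 → VField := fun a m _ => if m = a then 1 else 0 with hA
  have sA : ∀ a, (A a).SmoothOn U := fun a m => contDiffOn_const
  have key : ∀ i j, pd i (pd j (bil g (A l) (A k))) p
      = bil g (nabla g i (nabla g j (A l))) (A k) p + bil g (nabla g j (A l)) (nabla g i (A k)) p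
      + (bil g (nabla g i (A l)) (nabla g j (A k)) p
        + bil g (A l) (nabla g i (nabla g j (A k))) p) := by
    intro i j
    rw [pd_congr hU (fun x hx => hg.pd_bil hU (sA l) (sA k) hx j) hp,
      pd_add (differentiableAt_of_contDiffOn hU
        (hg.contDiffOn_bil (hg.smoothOn_nabla hU (sA l) j) (sA k)) hp)
        (differentiableAt_of_contDiffOn hU
        (hg.contDiffOn_bil (sA l) (hg.smoothOn_nabla hU (sA k) j)) hp),
      hg.pd_bil hU (hg.smoothOn_nabla hU (sA l) j) (sA k) hp,
      hg.pd_bil hU (sA l) (hg.smoothOn_nabla hU (sA k) j) hp]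
  have h := pd_comm hU (hg.contDiffOn_bil (sA l) (sA k)) hp i j
  rw [key, key] at h
  have ev : ∀ a b, bil g (A a) (nabla g i (nabla g j (A b))) p
      - bil g (A a) (nabla g j (nabla g i (A b))) p = riemann g a b i j p := by
    intro a b
    have hn := hg.nabla_nabla hU (sA b) hp i j
    unfold bil riemann
    simp only [← Finset.sum_sub_distrib, ← mul_sub, hn]
    simp [hA]
  have c := fun A B => hg.bil_comm hp A B
  have h1 := ev l k
  have h2 := ev k l
  rw [c (nabla g i (nabla g j (A l))), c (nabla g j (nabla g i (A l)))] at h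
  linarith

end IsMetricOn

/-! ### Two-forms, the Hodge star and null frames at a point -/

/-- The Gram matrix of a null frame, up to a factor. -/
def nullGram : Matrix (Fin 4) (Fin 4) ℝ :=
  !![0, 0, 0, 1; 0, 0, -1, 0; 0, -1, 0, 0; 1, 0, 0, 0]

/-- The general antisymmetric matrix. -/
def skew (a b c d e f : ℝ) : Matrix (Fin 4) (Fin 4) ℝ :=
  !![0, a, b, c; -a, 0, d, e; -b, -d, 0, f; -c, -e, -f, 0]

theorem eq_skew {C : Matrix (Fin 4) (Fin 4) ℝ} (hC : ∀ i j, C i j = - C j i) :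
    C = skew (C 0 1) (C 0 2) (C 0 3) (C 1 2) (C 1 3) (C 2 3) := by
  have hd : ∀ i, C i i = 0 := fun i => by linarith [hC i i]
  ext i j
  fin_cases i <;> fin_cases j <;> simp [skew, hd] <;> exact hC _ _

/-- The metric-independent dual of a bivector. -/
def bivectorDual (C : Matrix (Fin 4) (Fin 4) ℝ) : Matrix (Fin 4) (Fin 4) ℝ :=
  Matrix.of fun i j => (1 / 2) * ∑ k, ∑ l, (leviCivita i j k l : ℝ) * C k l

/-- The right side is a Vandermonde product: it vanishes when two indices coincide and is
alternating, and on `0, 1, 2, 3` it equals `1! 2! 3! = 12`. This makes the symbol accessible to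
polynomial arithmetic. -/
theorem leviCivita_mul_twelve (i j k l : Fin 4) :
    12 * leviCivita i j k l = ((j : ℤ) - i) * ((k : ℤ) - i) * ((l : ℤ) - i) * ((k : ℤ) - j)
      * ((l : ℤ) - j) * ((l : ℤ) - k) := by
  revert i j k l
  decide +kernel

theorem leviCivita_cast (i j k l : Fin 4) :
    (leviCivita i j k l : ℝ) = ((((j : ℕ) : ℝ) - (i : ℕ)) * (((k : ℕ) : ℝ) - (i : ℕ))
      * (((l : ℕ) : ℝ) - (i : ℕ)) * (((k : ℕ) : ℝ) - (j : ℕ)) * (((l : ℕ) : ℝ) - (j : ℕ))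
      * (((l : ℕ) : ℝ) - (k : ℕ))) / 12 := by
  have h := congrArg (Int.cast : ℤ → ℝ) (leviCivita_mul_twelve i j k l)
  push_cast at h
  linarith

theorem bivectorDual_skew (a b c d e f : ℝ) :
    bivectorDual (skew a b c d e f) = skew f (-e) d c (-b) a := by
  ext i j
  simp only [bivectorDual, Matrix.of_apply, Fin.sum_univ_four, leviCivita_cast]
  fin_cases i <;> fin_cases j <;> simp [skew] <;> ring

theorem bivectorDual_smul (s : ℝ) (C : Matrix (Fin 4) (Fin 4) ℝ) :
    bivectorDual (s • C) = s • bivectorDual C := by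
  ext i j
  simp only [bivectorDual, Matrix.of_apply, Matrix.smul_apply, smul_eq_mul, Finset.mul_sum]
  exact Finset.sum_congr rfl fun k _ => Finset.sum_congr rfl fun l _ => by ring

theorem transpose_mul_skew_mul (M : Matrix (Fin 4) (Fin 4) ℝ) (a b c d e f : ℝ) (i j : Fin 4) :
    (M.transpose * skew a b c d e f * M) i j
      = a * (M 0 i * M 1 j - M 1 i * M 0 j) + b * (M 0 i * M 2 j - M 2 i * M 0 j)
        + c * (M 0 i * M 3 j - M 3 i * M 0 j) + d * (M 1 i * M 2 j - M 2 i * M 1 j)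
        + e * (M 1 i * M 3 j - M 3 i * M 1 j) + f * (M 2 i * M 3 j - M 3 i * M 2 j) := by
  simp [Matrix.mul_apply, Fin.sum_univ_four, skew]
  ring

/-- Laplace expansion along the first two rows. It is written in 2 by 2 minors because those are the
coefficients by which `M` acts on bivectors. -/
theorem det_four (M : Matrix (Fin 4) (Fin 4) ℝ) : M.det =
    (M 0 0 * M 1 1 - M 1 0 * M 0 1) * (M 2 2 * M 3 3 - M 3 2 * M 2 3)
    - (M 0 0 * M 1 2 - M 1 0 * M 0 2) * (M 2 1 * M 3 3 - M 3 1 * M 2 3)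
    + (M 0 0 * M 1 3 - M 1 0 * M 0 3) * (M 2 1 * M 3 2 - M 3 1 * M 2 2)
    + (M 0 1 * M 1 2 - M 1 1 * M 0 2) * (M 2 0 * M 3 3 - M 3 0 * M 2 3)
    - (M 0 1 * M 1 3 - M 1 1 * M 0 3) * (M 2 0 * M 3 2 - M 3 0 * M 2 2)
    + (M 0 2 * M 1 3 - M 1 2 * M 0 3) * (M 2 0 * M 3 1 - M 3 0 * M 2 1) := by
  simp [Matrix.det_succ_row_zero, Fin.sum_univ_succ, Fin.succAbove]
  ring

/-- The Levi-Civita symbol transforms under `M` by the factor `det M`; in minors, these are the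
Laplace expansions of the determinant along pairs of rows. -/
theorem bivectorDual_congruence (M C : Matrix (Fin 4) (Fin 4) ℝ) (hC : ∀ i j, C i j = - C j i) :
    M * bivectorDual (M.transpose * C * M) * M.transpose = M.det • bivectorDual C := by
  have hA : ∀ i j, (M.transpose * C * M) i j = - (M.transpose * C * M) j i := by
    intro i j
    rw [eq_skew hC, transpose_mul_skew_mul, transpose_mul_skew_mul]; ring
  rw [eq_skew hA, bivectorDual_skew, eq_skew hC, bivectorDual_skew]
  simp only [transpose_mul_skew_mul]
  rw [← Matrix.transpose_transpose M]
  ext i j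
  rw [Matrix.transpose_transpose M.transpose, transpose_mul_skew_mul]
  simp only [Matrix.transpose_transpose, Matrix.transpose_apply, Matrix.smul_apply, det_four]
  fin_cases i <;> fin_cases j <;> simp [skew] <;> ring

/-- The rows of `M` form a null frame of the metric `G`. -/
structure IsNullFrame (G M : Matrix (Fin 4) (Fin 4) ℝ) (h : ℝ) : Prop where
  ne_zero : h ≠ 0
  gram : M * G * M.transpose = h • nullGram

theorem nullGram_mul_self : nullGram * nullGram = 1 := by
  ext i j
  fin_cases i <;> fin_cases j <;> simp [nullGram, Matrix.mul_apply, Fin.sum_univ_four]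

theorem det_nullGram : nullGram.det = 1 := by
  simp [det_four, nullGram]

namespace IsNullFrame

variable {G M : Matrix (Fin 4) (Fin 4) ℝ} {h : ℝ} (H : IsNullFrame G M h)
include H

theorem det_sq : M.det ^ 2 * G.det = h ^ 4 := by
  have := congrArg Matrix.det H.gram
  rw [Matrix.det_mul, Matrix.det_mul, Matrix.det_transpose, Matrix.det_smul, det_nullGram] at this
  simp at this
  linarith

theorem det_ne_zero : M.det ≠ 0 := fun h0 => by
  have := H.det_sq
  rw [h0] at this
  exact pow_ne_zero 4 H.ne_zero (by linarith)

theorem det_metric_ne_zero : G.det ≠ 0 := fun h0 => by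
  have := H.det_sq
  rw [h0] at this
  exact pow_ne_zero 4 H.ne_zero (by linarith)

theorem inv_eq : G⁻¹ = h⁻¹ • (M.transpose * nullGram * M) := by
  apply Matrix.inv_eq_right_inv
  have h1 : M * (h⁻¹ • (G * M.transpose * nullGram)) = 1 := by
    rw [Matrix.mul_smul, ← Matrix.mul_assoc, ← Matrix.mul_assoc, H.gram, Matrix.smul_mul,
      nullGram_mul_self, smul_smul, inv_mul_cancel₀ H.ne_zero, one_smul]
  have h2 := mul_eq_one_comm.1 h1
  rw [← h2]
  simp [Matrix.mul_assoc]

theorem inv_apply (i j : Fin 4) : G⁻¹ i j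
    = h⁻¹ * (M 0 i * M 3 j + M 3 i * M 0 j - M 1 i * M 2 j - M 2 i * M 1 j) := by
  rw [H.inv_eq]
  simp [Matrix.mul_apply, Fin.sum_univ_four, nullGram]
  ring_nf
  simp

/-- Allows identities between 2-tensors to be checked on the frame. -/
theorem congruence_cancel {A B : Matrix (Fin 4) (Fin 4) ℝ}
    (hAB : M * A * M.transpose = M * B * M.transpose) : A = B := by
  have hM : IsUnit M.det := isUnit_iff_ne_zero.2 H.det_ne_zero
  have hM' : IsUnit M.transpose.det := by rwa [Matrix.det_transpose]
  have h1 := congrArg (fun X => M⁻¹ * X * M.transpose⁻¹) hAB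
  simpa [Matrix.mul_assoc, Matrix.mul_nonsing_inv _ hM', Matrix.nonsing_inv_mul_cancel_left _ _ hM]
    using h1

/-- The volume form evaluated on a positively oriented null frame: the Gram determinant is `h ^ 4`,
and the orientation fixes the sign of the square root. -/
theorem volume_factor {η : ℝ} (hη : 0 < η * M.det) :
    Real.sign η * Real.sqrt |G.det| * M.det = h ^ 2 := by
  have h1 : Real.sqrt |G.det| * |M.det| = h ^ 2 := by
    have h2 : |G.det| * M.det ^ 2 = (h ^ 2) ^ 2 := by
      rw [← abs_of_nonneg (sq_nonneg M.det), ← abs_mul, mul_comm, H.det_sq,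
        abs_of_nonneg (by positivity)]
      ring
    rw [← Real.sqrt_sq_eq_abs M.det, ← Real.sqrt_mul (abs_nonneg _), h2,
      Real.sqrt_sq (by positivity)]
  rcases lt_trichotomy η 0 with h0 | h0 | h0
  · have : M.det < 0 := by nlinarith
    rw [Real.sign_of_neg h0, ← h1, abs_of_neg this]; ring
  · simp [h0] at hη
  · have : 0 < M.det := by nlinarith
    rw [Real.sign_of_pos h0, ← h1, abs_of_pos this]; ring

end IsNullFrame

/-- A two-form that vanishes on the bivectors `(E₀ + λ E₁) ∧ (E₂ + λ E₃)` is self-dual. -/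
theorem hodgeStar_eq_self {g : MetricField} {η : R4 → ℝ} {p : R4}
    {M : Matrix (Fin 4) (Fin 4) ℝ} {h : ℝ} (H : IsNullFrame (g p) M h) (hη : 0 < η p * M.det)
    {α : Matrix (Fin 4) (Fin 4) ℝ} (hα : ∀ i j, α i j = - α j i)
    (h02 : (M * α * M.transpose) 0 2 = 0) (h13 : (M * α * M.transpose) 1 3 = 0)
    (h0312 : (M * α * M.transpose) 0 3 + (M * α * M.transpose) 1 2 = 0) (i j : Fin 4) :
    hodgeStar g η p α i j = α i j := by
  set β := M * α * M.transpose with hβ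
  have hβs : ∀ i j, β i j = - β j i := by
    intro i j
    have : β.transpose = - β := by
      have hαt : α.transpose = - α := by ext i j; simpa using hα j i
      simp [hβ, Matrix.transpose_mul, hαt, Matrix.mul_assoc]
    have := congrFun (congrFun this j) i
    simpa using this
  set s := Real.sign (η p) * Real.sqrt |(g p).det| with hs
  have e1 : Matrix.of (hodgeStar g η p α)
      = s • bivectorDual ((g p)⁻¹ * α * (g p)⁻¹.transpose) := by
    ext i j
    simp only [hodgeStar, volForm, bivectorDual, Matrix.of_apply, Matrix.smul_apply, smul_eq_mul,
      Matrix.mul_apply, Matrix.transpose_apply, Finset.mul_sum, Finset.sum_mul]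
    refine Finset.sum_congr rfl fun k _ => Finset.sum_congr rfl fun l _ => ?_
    rw [Finset.sum_comm]
    exact Finset.sum_congr rfl fun m _ => Finset.sum_congr rfl fun n _ => by rw [hs]; ring
  have hJt : nullGram.transpose = nullGram := by
    ext i j; fin_cases i <;> fin_cases j <;> simp [nullGram]
  have e2 : (g p)⁻¹ * α * (g p)⁻¹.transpose
      = (h⁻¹ * h⁻¹) • (M.transpose * (nullGram * β * nullGram) * M) := by
    rw [H.inv_eq]
    simp [Matrix.transpose_mul, hJt, Matrix.mul_assoc, hβ, smul_smul]
  have e3 : nullGram * β * nullGram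
      = skew (β 2 3) (β 1 3) (-β 0 3) (-β 1 2) (β 0 2) (β 0 1) := by
    rw [eq_skew hβs]
    ext i j
    fin_cases i <;> fin_cases j <;>
      simp [nullGram, Matrix.mul_apply, Fin.sum_univ_four, skew]
  -- In frame components the star keeps `β 0 1` and `β 2 3`, changes the signs of `β 0 2` and `β 1
  -- 3`, and sends `β 0 3` to `-β 1 2`. The three hypotheses say exactly that `β` is fixed.
  have e4 : M * Matrix.of (hodgeStar g η p α) * M.transpose = M * α * M.transpose := by
    rw [e1, e2, bivectorDual_smul, Matrix.mul_smul, Matrix.mul_smul, Matrix.smul_mul,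
      Matrix.smul_mul, bivectorDual_congruence, smul_smul, smul_smul]
    · have : s * h⁻¹ * h⁻¹ * M.det = 1 := by
        have := H.volume_factor hη
        rw [← hs] at this
        have h0 := H.ne_zero
        field_simp
        linarith
      rw [← mul_assoc, this, one_smul, e3, bivectorDual_skew, ← hβ]
      conv_rhs => rw [eq_skew hβs]
      have h03 : β 0 3 = - β 1 2 := by linarith
      simp [h02, h13, h03]
    · intro i j
      rw [e3]
      fin_cases i <;> fin_cases j <;> simp [skew]
  exact congrFun (congrFun (H.congruence_cancel e4) i) j

/-! ### The anti-self-dual Weyl curvature in a null frame -/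

/-- The Ricci components of a curvature tensor in a null frame. -/
def frameRicci (r : Fin 4 → Fin 4 → Fin 4 → Fin 4 → ℝ) (b d : Fin 4) : ℝ :=
  r 3 b 0 d + r 0 b 3 d - r 2 b 1 d - r 1 b 2 d

/-- The Weyl components of a curvature tensor in a null frame. -/
def frameWeyl (r : Fin 4 → Fin 4 → Fin 4 → Fin 4 → ℝ) (a b c d : Fin 4) : ℝ :=
  r a b c d - (1 / 2) * (nullGram a c * frameRicci r b d - nullGram a d * frameRicci r b c
      - nullGram b c * frameRicci r a d + nullGram b d * frameRicci r a c)
    + (frameRicci r 3 0 + frameRicci r 0 3 - frameRicci r 2 1 - frameRicci r 1 2) / 6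
      * (nullGram a c * nullGram b d - nullGram a d * nullGram b c)

/-- The classical octahedron argument: combine the four cyclic instances of the Bianchi identity and
cancel by antisymmetry. -/
theorem pair_symm {r : Fin 4 → Fin 4 → Fin 4 → Fin 4 → ℝ}
    (hl : ∀ a b c d, r a b c d = - r b a c d) (hr : ∀ a b c d, r a b c d = - r a b d c)
    (hb : ∀ a b c d, r a b c d + r a c d b + r a d b c = 0) (a b c d : Fin 4) :
    r a b c d = r c d a b := by
  linarith [hb a b c d, hb b c d a, hb c d a b, hb d a b c, hl a c d b, hr a c d b, hl a d b c,
    hr a d b c, hl b c d a, hl b d a c, hr b d a c, hl b a c d, hr b a c d, hl c d a b, hl c a b d,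
    hr c a b d, hl c b d a, hr c b d a, hl d a b c, hr d a b c, hl d b c a, hr d b c a,
    hl d c a b, hr d c a b, hr b c d a, hr a b c d, hr c d a b, hr b a d c, hr d c b a]

/-- The bivectors `E₀ ∧ E₂`, `E₀ ∧ E₃ + E₁ ∧ E₂`, `E₁ ∧ E₃` span the anti-self-dual ones. Removing
the Ricci terms kills the pairing of these with self-dual bivectors and the trace of the curvature
form on them. The five hypotheses, the coefficients of the quartic, kill the remaining trace-free
part. -/
theorem frameWeyl_eq_zero {r : Fin 4 → Fin 4 → Fin 4 → Fin 4 → ℝ}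
    (hl : ∀ a b c d, r a b c d = - r b a c d) (hr : ∀ a b c d, r a b c d = - r a b d c)
    (hb : ∀ a b c d, r a b c d + r a c d b + r a d b c = 0)
    (h0 : r 0 2 0 2 = 0) (h1 : r 0 2 0 3 + r 0 2 1 2 = 0)
    (h2 : r 0 3 0 3 + 2 * r 0 3 1 2 + r 1 2 1 2 + 2 * r 0 2 1 3 = 0)
    (h3 : r 0 3 1 3 + r 1 2 1 3 = 0) (h4 : r 1 3 1 3 = 0) (c d : Fin 4) :
    frameWeyl r 0 2 c d = 0 ∧ frameWeyl r 1 3 c d = 0 ∧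
      frameWeyl r 0 3 c d + frameWeyl r 1 2 c d = 0 := by
  have hp := pair_symm hl hr hb
  have dl : ∀ a c d, r a a c d = 0 := fun a c d => by linarith [hl a a c d]
  have dr : ∀ a b c, r a b c c = 0 := fun a b c => by linarith [hr a b c c]
  have l1 := fun c d => hl 1 0 c d
  have l2 := fun c d => hl 2 0 c d
  have l3 := fun c d => hl 3 0 c d
  have l4 := fun c d => hl 2 1 c d
  have l5 := fun c d => hl 3 1 c d
  have l6 := fun c d => hl 3 2 c d
  have r1 := fun a b => hr a b 1 0
  have r2 := fun a b => hr a b 2 0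
  have r3 := fun a b => hr a b 3 0
  have r4 := fun a b => hr a b 2 1
  have r5 := fun a b => hr a b 3 1
  have r6 := fun a b => hr a b 3 2
  -- The one Bianchi identity with four distinct indices, the only relation not already contained in
  -- the antisymmetries and the pair symmetry.
  have b1 := hb 0 1 2 3
  rw [hr 0 3 1 2, hr 0 2 3 1] at b1
  fin_cases c <;> fin_cases d <;>
    simp [frameWeyl, frameRicci, nullGram, dl, dr, l1, l2, l3, l4, l5, l6, r1, r2, r3, r4, r5, r6,
      hp 0 2 0 1, hp 0 3 0 1, hp 1 2 0 1, hp 1 3 0 1, hp 2 3 0 1, hp 0 3 0 2, hp 1 2 0 2,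
      hp 1 3 0 2, hp 2 3 0 2, hp 1 2 0 3, hp 1 3 0 3, hp 2 3 0 3, hp 1 3 1 2, hp 2 3 1 2,
      hp 2 3 1 3] at b1 h0 h1 h2 h3 h4 ⊢ <;>
    (repeat' apply And.intro) <;> linarith

theorem congruence_apply (M F : Matrix (Fin 4) (Fin 4) ℝ) (a b : Fin 4) :
    (M * F * M.transpose) a b = ∑ m, ∑ n, F m n * M a m * M b n := by
  simp only [Matrix.mul_apply, Matrix.transpose_apply, Finset.sum_mul]
  rw [Finset.sum_comm]
  exact Finset.sum_congr rfl fun m _ => Finset.sum_congr rfl fun n _ => by ring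

/-! ### Ricci, scalar and Weyl curvature in a null frame. -/

section FrameComponents

variable {g : MetricField} {p : R4} {M : Matrix (Fin 4) (Fin 4) ℝ} {h : ℝ}

/-- The components of the curvature in the frame formed by the rows of `M`. -/
def frameCurv (g : MetricField) (p : R4) (M : Matrix (Fin 4) (Fin 4) ℝ) (a b c d : Fin 4) : ℝ :=
  curv g p (M a) (M b) (M c) (M d)

theorem IsNullFrame.gram_apply (H : IsNullFrame (g p) M h) (a b : Fin 4) :
    ∑ i, ∑ j, g p i j * M a i * M b j = h * nullGram a b := by
  rw [← congruence_apply, H.gram, Matrix.smul_apply, smul_eq_mul]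

theorem riemannUp_eq (hdet : (g p).det ≠ 0) (l k i j : Fin 4) :
    riemannUp g l k i j p = ∑ m, (g p)⁻¹ l m * riemann g m k i j p := by
  have h1 : (g p)⁻¹.mulVec ((g p).mulVec fun m => riemannUp g m k i j p)
      = fun m => riemannUp g m k i j p := by
    rw [Matrix.mulVec_mulVec, Matrix.nonsing_inv_mul _ (isUnit_iff_ne_zero.2 hdet),
      Matrix.one_mulVec]
  exact (congrFun h1 l).symm

/-- The trace defining Ricci is taken with the inverse metric written in the frame, `h⁻¹ (E₀ E₃ + E₃
E₀ - E₁ E₂ - E₂ E₁)`. -/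
theorem IsNullFrame.ricci_apply (H : IsNullFrame (g p) M h) (B D : Fin 4 → ℝ) :
    ∑ k, ∑ j, ricci g k j p * B k * D j
      = h⁻¹ * (curv g p (M 3) B (M 0) D + curv g p (M 0) B (M 3) D
          - curv g p (M 2) B (M 1) D - curv g p (M 1) B (M 2) D) := by
  have e : ∀ A C : Fin 4 → ℝ, curv g p A B C D
      = ∑ k, ∑ j, (∑ i, ∑ l, riemann g l k i j p * A l * C i) * B k * D j := by
    intro A C
    unfold curv
    rw [Finset.sum_comm]
    refine Finset.sum_congr rfl fun k _ => ?_
    simp only [Finset.sum_mul]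
    symm
    rw [Finset.sum_comm]
    symm
    rw [Finset.sum_comm]
    refine Finset.sum_congr rfl fun i _ => ?_
    rw [Finset.sum_comm]
    exact Finset.sum_congr rfl fun j _ => Finset.sum_congr rfl fun l _ => by ring
  simp only [e, ← Finset.sum_add_distrib, ← Finset.sum_sub_distrib, Finset.mul_sum]
  refine Finset.sum_congr rfl fun k _ => Finset.sum_congr rfl fun j _ => ?_
  rw [← sub_eq_zero]
  simp only [ricci, riemannUp_eq H.det_metric_ne_zero, H.inv_apply, ← add_mul, ← sub_mul,
    ← Finset.sum_add_distrib, ← Finset.sum_sub_distrib]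
  rw [← mul_assoc, ← mul_assoc, ← sub_mul, ← sub_mul, Finset.mul_sum, ← Finset.sum_sub_distrib]
  simp only [Finset.mul_sum, ← Finset.sum_sub_distrib]
  rw [Finset.sum_eq_zero, zero_mul, zero_mul]
  exact fun i _ => Finset.sum_eq_zero fun l _ => by ring

theorem IsNullFrame.ricci_frame (H : IsNullFrame (g p) M h) (b d : Fin 4) :
    ∑ k, ∑ j, ricci g k j p * M b k * M d j = h⁻¹ * frameRicci (frameCurv g p M) b d :=
  H.ricci_apply _ _

theorem IsNullFrame.scalarCurv_eq (H : IsNullFrame (g p) M h) :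
    scalarCurv g p = h⁻¹ * h⁻¹ * (frameRicci (frameCurv g p M) 3 0
      + frameRicci (frameCurv g p M) 0 3 - frameRicci (frameCurv g p M) 2 1
      - frameRicci (frameCurv g p M) 1 2) := by
  have e : scalarCurv g p = h⁻¹ * (∑ k, ∑ j, ricci g k j p * M 3 k * M 0 j
      + ∑ k, ∑ j, ricci g k j p * M 0 k * M 3 j - ∑ k, ∑ j, ricci g k j p * M 2 k * M 1 j
      - ∑ k, ∑ j, ricci g k j p * M 1 k * M 2 j) := by
    simp only [scalarCurv, H.inv_apply, ← Finset.sum_add_distrib, ← Finset.sum_sub_distrib,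
      Finset.mul_sum]
    exact Finset.sum_congr rfl fun k _ => Finset.sum_congr rfl fun j _ => by ring
  rw [e, H.ricci_frame, H.ricci_frame, H.ricci_frame, H.ricci_frame]
  ring

theorem sum_mul_sum_pairs (P Q : Fin 4 → Fin 4 → ℝ) (A B C D : Fin 4 → ℝ) :
    ∑ l, ∑ k, ∑ i, ∑ j, P l i * Q k j * A l * B k * C i * D j
      = (∑ l, ∑ i, P l i * A l * C i) * ∑ k, ∑ j, Q k j * B k * D j := by
  simp only [Finset.sum_mul]
  refine Finset.sum_congr rfl fun l _ => ?_
  rw [Finset.sum_comm]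
  simp only [Finset.mul_sum]
  refine Finset.sum_congr rfl fun i _ => Finset.sum_congr rfl fun k _ =>
    Finset.sum_congr rfl fun j _ => by ring

theorem sum_swap_last (T : Fin 4 → Fin 4 → Fin 4 → Fin 4 → ℝ) :
    ∑ l, ∑ k, ∑ i, ∑ j, T l k i j = ∑ l, ∑ k, ∑ j, ∑ i, T l k i j :=
  Finset.sum_congr rfl fun _ _ => Finset.sum_congr rfl fun _ _ => Finset.sum_comm

theorem sum_swap_pairs (T : Fin 4 → Fin 4 → Fin 4 → Fin 4 → ℝ) :
    ∑ k, ∑ l, ∑ m, ∑ n, T k l m n = ∑ m, ∑ n, ∑ k, ∑ l, T k l m n := by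
  have h := Finset.sum_comm (s := (Finset.univ : Finset (Fin 4 × Fin 4)))
    (t := (Finset.univ : Finset (Fin 4 × Fin 4))) (f := fun x y => T x.1 x.2 y.1 y.2)
  simpa only [Fintype.sum_prod_type] using h

/-- No power of `h` survives: each metric factor contributes `h` and each trace `h⁻¹`, and they
occur equally often in every correction term. -/
theorem IsNullFrame.weyl_frame (H : IsNullFrame (g p) M h) (a b c d : Fin 4) :
    ∑ l, ∑ k, ∑ i, ∑ j, weyl g l k i j p * M a l * M b k * M c i * M d j
      = frameWeyl (frameCurv g p M) a b c d := by
  have q : ∀ P Q : Fin 4 → Fin 4 → ℝ, ∀ a b c d,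
      ∑ l, ∑ k, ∑ i, ∑ j, P l i * Q k j * M a l * M b k * M c i * M d j
      = (∑ l, ∑ i, P l i * M a l * M c i) * ∑ k, ∑ j, Q k j * M b k * M d j :=
    fun P Q a b c d => sum_mul_sum_pairs P Q _ _ _ _
  have q' : ∀ P Q : Fin 4 → Fin 4 → ℝ, ∀ a b c d,
      ∑ l, ∑ k, ∑ i, ∑ j, P l j * Q k i * M a l * M b k * M c i * M d j
      = (∑ l, ∑ i, P l i * M a l * M d i) * ∑ k, ∑ j, Q k j * M b k * M c j := by
    intro P Q a b c d
    rw [sum_swap_last, ← q]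
    exact Finset.sum_congr rfl fun _ _ => Finset.sum_congr rfl fun _ _ => Finset.sum_congr rfl
      fun _ _ => Finset.sum_congr rfl fun _ _ => by ring
  have e : ∀ l k i j, weyl g l k i j p * M a l * M b k * M c i * M d j
      = riemann g l k i j p * M a l * M b k * M c i * M d j
        - (1 / 2) * (g p l i * ricci g k j p * M a l * M b k * M c i * M d j)
        + (1 / 2) * (g p l j * ricci g k i p * M a l * M b k * M c i * M d j)
        + (1 / 2) * (ricci g l j p * g p k i * M a l * M b k * M c i * M d j)
        - (1 / 2) * (ricci g l i p * g p k j * M a l * M b k * M c i * M d j)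
        + (scalarCurv g p / 6) * (g p l i * g p k j * M a l * M b k * M c i * M d j)
        - (scalarCurv g p / 6) * (g p l j * g p k i * M a l * M b k * M c i * M d j) := by
    intro l k i j; unfold weyl; ring
  simp only [e, Finset.sum_add_distrib, Finset.sum_sub_distrib, ← Finset.mul_sum]
  rw [q (g p) (fun k j => ricci g k j p), q' (g p) (fun k j => ricci g k j p),
    q (fun k j => ricci g k j p) (g p), q' (fun k j => ricci g k j p) (g p), q (g p) (g p),
    q' (g p) (g p)]
  simp only [H.gram_apply, H.ricci_frame, H.scalarCurv_eq]
  have h0 := H.ne_zero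
  have hc : ∑ l, ∑ k, ∑ i, ∑ j, riemann g l k i j p * M a l * M b k * M c i * M d j
      = frameCurv g p M a b c d := rfl
  rw [hc]
  unfold frameWeyl
  field_simp
  ring

end FrameComponents

/-! ### Multilinearity and symmetries of the curvature on vectors. -/

section CurvSymmetries

theorem curv_add_smul₁ (g : MetricField) (p : R4) (A A' B C D : Fin 4 → ℝ) (t : ℝ) :
    curv g p (A + t • A') B C D = curv g p A B C D + t * curv g p A' B C D := by
  simp only [curv, Finset.mul_sum, ← Finset.sum_add_distrib]
  exact Finset.sum_congr rfl fun _ _ => Finset.sum_congr rfl fun _ _ => Finset.sum_congr rfl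
    fun _ _ => Finset.sum_congr rfl fun _ _ => by simp; ring

theorem curv_add_smul₂ (g : MetricField) (p : R4) (A B B' C D : Fin 4 → ℝ) (t : ℝ) :
    curv g p A (B + t • B') C D = curv g p A B C D + t * curv g p A B' C D := by
  simp only [curv, Finset.mul_sum, ← Finset.sum_add_distrib]
  exact Finset.sum_congr rfl fun _ _ => Finset.sum_congr rfl fun _ _ => Finset.sum_congr rfl
    fun _ _ => Finset.sum_congr rfl fun _ _ => by simp; ring

theorem curv_add_smul₃ (g : MetricField) (p : R4) (A B C C' D : Fin 4 → ℝ) (t : ℝ) :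
    curv g p A B (C + t • C') D = curv g p A B C D + t * curv g p A B C' D := by
  simp only [curv, Finset.mul_sum, ← Finset.sum_add_distrib]
  exact Finset.sum_congr rfl fun _ _ => Finset.sum_congr rfl fun _ _ => Finset.sum_congr rfl
    fun _ _ => Finset.sum_congr rfl fun _ _ => by simp; ring

theorem curv_add_smul₄ (g : MetricField) (p : R4) (A B C D D' : Fin 4 → ℝ) (t : ℝ) :
    curv g p A B C (D + t • D') = curv g p A B C D + t * curv g p A B C D' := by
  simp only [curv, Finset.mul_sum, ← Finset.sum_add_distrib]
  exact Finset.sum_congr rfl fun _ _ => Finset.sum_congr rfl fun _ _ => Finset.sum_congr rfl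
    fun _ _ => Finset.sum_congr rfl fun _ _ => by simp; ring

theorem curv_swap_right (g : MetricField) (p : R4) (A B C D : Fin 4 → ℝ) :
    curv g p A B C D = - curv g p A B D C := by
  unfold curv
  rw [sum_swap_last]
  simp only [← Finset.sum_neg_distrib]
  refine Finset.sum_congr rfl fun l _ => Finset.sum_congr rfl fun k _ => Finset.sum_congr rfl
    fun i _ => Finset.sum_congr rfl fun j _ => ?_
  rw [riemann_swap_right]; ring

variable {g : MetricField} {U : Set R4} (hg : IsMetricOn g U) (hU : IsOpen U) {p : R4} (hp : p ∈ U)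
include hg hU hp

theorem curv_swap_left (A B C D : Fin 4 → ℝ) : curv g p A B C D = - curv g p B A C D := by
  unfold curv
  rw [Finset.sum_comm]
  simp only [← Finset.sum_neg_distrib]
  refine Finset.sum_congr rfl fun l _ => Finset.sum_congr rfl fun k _ => Finset.sum_congr rfl
    fun i _ => Finset.sum_congr rfl fun j _ => ?_
  rw [hg.riemann_swap_left hU hp]; ring

theorem curv_bianchi (A B C D : Fin 4 → ℝ) :
    curv g p A B C D + curv g p A C D B + curv g p A D B C = 0 := by
  have e1 : curv g p A C D B
      = ∑ l, ∑ k, ∑ i, ∑ j, riemann g l i j k p * A l * C i * D j * B k := by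
    refine Finset.sum_congr rfl fun l _ => ?_
    symm
    rw [Finset.sum_comm]
    exact Finset.sum_congr rfl fun i _ => Finset.sum_comm
  have e2 : curv g p A D B C
      = ∑ l, ∑ k, ∑ i, ∑ j, riemann g l j k i p * A l * D j * B k * C i := by
    refine Finset.sum_congr rfl fun l _ => ?_
    rw [Finset.sum_comm]
    exact Finset.sum_congr rfl fun k _ => Finset.sum_comm
  rw [e1, e2]
  simp only [curv, ← Finset.sum_add_distrib]
  refine Finset.sum_eq_zero fun l _ => Finset.sum_eq_zero fun k _ => Finset.sum_eq_zero
    fun i _ => Finset.sum_eq_zero fun j _ => ?_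
  linear_combination (A l * B k * C i * D j) * hg.riemann_bianchi hU hp l k i j

end CurvSymmetries

/-- If the curvature vanishes on all null planes `⟨E₀ + λ E₁, E₂ + λ E₃⟩` of a null frame with the
right orientation, then the Weyl tensor is self-dual. -/
theorem hodgeStar_weyl_eq {g : MetricField} {U : Set R4} (hg : IsMetricOn g U) (hU : IsOpen U)
    {p : R4} (hp : p ∈ U) {M : Matrix (Fin 4) (Fin 4) ℝ} {h : ℝ} (H : IsNullFrame (g p) M h)
    {η : R4 → ℝ} (hη : 0 < η p * M.det)
    (hc : ∀ t : ℝ, curv g p (M 0 + t • M 1) (M 2 + t • M 3) (M 0 + t • M 1) (M 2 + t • M 3) = 0)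
    (i j k l : Fin 4) :
    hodgeStar g η p (fun m n => weyl g m n k l p) i j = weyl g i j k l p := by
  have hl : ∀ a b c d, frameCurv g p M a b c d = - frameCurv g p M b a c d :=
    fun a b c d => curv_swap_left hg hU hp _ _ _ _
  have hr : ∀ a b c d, frameCurv g p M a b c d = - frameCurv g p M a b d c :=
    fun a b c d => curv_swap_right g p _ _ _ _
  have hb : ∀ a b c d, frameCurv g p M a b c d + frameCurv g p M a c d b
      + frameCurv g p M a d b c = 0 := fun a b c d => curv_bianchi hg hU hp _ _ _ _
  have hs := pair_symm hl hr hb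
  have hq : ∀ t : ℝ, frameCurv g p M 0 2 0 2 + 2 * t * (frameCurv g p M 0 2 0 3
      + frameCurv g p M 0 2 1 2) + t ^ 2 * (frameCurv g p M 0 3 0 3 + 2 * frameCurv g p M 0 3 1 2
      + frameCurv g p M 1 2 1 2 + 2 * frameCurv g p M 0 2 1 3)
      + 2 * t ^ 3 * (frameCurv g p M 0 3 1 3 + frameCurv g p M 1 2 1 3)
      + t ^ 4 * frameCurv g p M 1 3 1 3 = 0 := by
    intro t
    have := hc t
    simp only [curv_add_smul₁, curv_add_smul₂, curv_add_smul₃, curv_add_smul₄] at this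
    have hd : ∀ a b c d, curv g p (M a) (M b) (M c) (M d) = frameCurv g p M a b c d :=
      fun _ _ _ _ => rfl
    simp only [hd] at this
    rw [hs 0 3 0 2, hs 1 2 0 2, hs 1 2 0 3, hs 1 3 0 2, hs 1 3 0 3, hs 1 3 1 2] at this
    linear_combination this
  -- Five values of the parameter determine the five coefficients of a quartic.
  have q0 := hq 0
  have q1 := hq 1
  have q2 := hq (-1)
  have q3 := hq 2
  have q4 := hq (-2)
  norm_num at q0 q1 q2 q3 q4
  have hw := frameWeyl_eq_zero hl hr hb (by linarith) (by linarith) (by linarith) (by linarith)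
    (by linarith)
  have hcd : ∀ a b c d, (M * Matrix.of (fun k l => (M * Matrix.of (fun m n => weyl g m n k l p)
      * M.transpose) a b) * M.transpose) c d = frameWeyl (frameCurv g p M) a b c d := by
    intro a b c d
    rw [← H.weyl_frame, sum_swap_pairs]
    simp only [congruence_apply, Matrix.of_apply, Finset.sum_mul]
  -- The vanishing is known with the last pair of indices in the frame; self-duality is wanted with
  -- that pair in coordinates.
  have key : ∀ F : Matrix (Fin 4) (Fin 4) ℝ, (∀ c d, (M * F * M.transpose) c d = 0) →
      ∀ k l, F k l = 0 := by
    intro F hF k l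
    have : F = 0 := H.congruence_cancel (by ext c d; simp [hF])
    simp [this]
  refine hodgeStar_eq_self H hη (α := Matrix.of fun m n => weyl g m n k l p) (fun m n => ?_)
    (key (Matrix.of fun k l => (M * Matrix.of (fun m n => weyl g m n k l p) * M.transpose) 0 2)
      (fun c d => by rw [hcd, (hw c d).1]) k l)
    (key (Matrix.of fun k l => (M * Matrix.of (fun m n => weyl g m n k l p) * M.transpose) 1 3)
      (fun c d => by rw [hcd, (hw c d).2.1]) k l)
    (key (Matrix.of (fun k l => (M * Matrix.of (fun m n => weyl g m n k l p) * M.transpose) 0 3)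
      + Matrix.of fun k l => (M * Matrix.of (fun m n => weyl g m n k l p) * M.transpose) 1 2)
      (fun c d => by
        rw [Matrix.mul_add, Matrix.add_mul, Matrix.add_apply, hcd, hcd, (hw c d).2.2]) k l) i j
  simp only [Matrix.of_apply, weyl]
  rw [hg.riemann_swap_left hU hp m n k l]
  ring

/-! ### Lax pairs -/

section Dir

variable {f f' : R4 → ℝ} {p : R4}

theorem dir_add (T : VField) (hf : DifferentiableAt ℝ f p) (hf' : DifferentiableAt ℝ f' p) :
    dir T (fun x => f x + f' x) p = dir T f p + dir T f' p := by
  simp only [dir, pd_add hf hf', mul_add, Finset.sum_add_distrib]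

theorem dir_sub (T : VField) (hf : DifferentiableAt ℝ f p) (hf' : DifferentiableAt ℝ f' p) :
    dir T (fun x => f x - f' x) p = dir T f p - dir T f' p := by
  simp only [dir, pd_sub hf hf', mul_sub, Finset.sum_sub_distrib]

theorem dir_mul (T : VField) (hf : DifferentiableAt ℝ f p) (hf' : DifferentiableAt ℝ f' p) :
    dir T (fun x => f x * f' x) p = dir T f p * f' p + f p * dir T f' p := by
  simp only [dir, pd_mul hf hf', Finset.sum_mul, Finset.mul_sum, ← Finset.sum_add_distrib]
  exact Finset.sum_congr rfl fun i _ => by ring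

theorem dir_congr {U : Set R4} (hU : IsOpen U) (h : ∀ x ∈ U, f x = f' x) (hp : p ∈ U)
    (T : VField) : dir T f p = dir T f' p := by
  simp only [dir, pd_congr hU h hp]

end Dir

/-- The vector field `A + t B`. -/
def pencil (A B : VField) (t : R4 → ℝ) : VField := fun k x => A k x + t x * B k x

theorem dir_pencil (A B : VField) (t f : R4 → ℝ) (p : R4) :
    dir (pencil A B t) f p = dir A f p + t p * dir B f p := by
  simp only [dir, pencil, Finset.mul_sum, ← Finset.sum_add_distrib]
  exact Finset.sum_congr rfl fun i _ => by ring

theorem smoothOn_pencil {U : Set R4} {A B : VField} {t : R4 → ℝ} (hA : A.SmoothOn U)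
    (hB : B.SmoothOn U) (ht : ContDiffOn ℝ ∞ t U) : (pencil A B t).SmoothOn U :=
  fun k => (hA k).add (ht.mul (hB k))

/-- A null frame `E` of `g` on `U` whose pencils `X = E₀ + λ E₁` and `Y = E₂ + λ E₃` lift to
commuting vector fields `X + (f₀ + λ f₁) ∂_λ` and `Y + (h₀ + λ h₁) ∂_λ`. -/
structure IsLaxFrame (g : MetricField) (U : Set R4) (E : Fin 4 → VField) (s f₀ f₁ h₀ h₁ : R4 → ℝ)
    (i₀ j₀ : Fin 4) : Prop where
  smooth : ∀ a, (E a).SmoothOn U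
  smooth_f₀ : ContDiffOn ℝ ∞ f₀ U
  smooth_f₁ : ContDiffOn ℝ ∞ f₁ U
  smooth_h₀ : ContDiffOn ℝ ∞ h₀ U
  smooth_h₁ : ContDiffOn ℝ ∞ h₁ U
  null : ∀ p ∈ U, IsNullFrame (g p) (Matrix.of fun a i => E a i p) (s p)
  coord_i₀ : ∀ p ∈ U, E 0 i₀ p = 1 ∧ E 1 i₀ p = 0 ∧ E 2 i₀ p = 0 ∧ E 3 i₀ p = 0
  coord_j₀ : ∀ p ∈ U, E 0 j₀ p = 0 ∧ E 1 j₀ p = 0 ∧ E 2 j₀ p = 1 ∧ E 3 j₀ p = 0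
  lie_eq : ∀ p ∈ U, ∀ (t : ℝ) (k : Fin 4),
    lie (pencil (E 0) (E 1) fun _ => t) (pencil (E 2) (E 3) fun _ => t) k p
      = (h₀ p + t * h₁ p) * E 1 k p - (f₀ p + t * f₁ p) * E 3 k p
  lift : ∀ p ∈ U, ∀ t : ℝ,
    dir (E 0) h₀ p + t * dir (E 1) h₀ p + t * (dir (E 0) h₁ p + t * dir (E 1) h₁ p)
        + (f₀ p + t * f₁ p) * h₁ p
      = dir (E 2) f₀ p + t * dir (E 3) f₀ p + t * (dir (E 2) f₁ p + t * dir (E 3) f₁ p)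
        + (h₀ p + t * h₁ p) * f₁ p

/-- The Lie bracket of two pencils with a variable parameter. -/
theorem lie_pencil {U : Set R4} (hU : IsOpen U) {A B C D : VField} (hA : A.SmoothOn U)
    (hB : B.SmoothOn U) (hC : C.SmoothOn U) (hD : D.SmoothOn U) {t : R4 → ℝ}
    (ht : ContDiffOn ℝ ∞ t U) {p : R4} (hp : p ∈ U) (k : Fin 4) :
    lie (pencil A B t) (pencil C D t) k p
      = lie (pencil A B fun _ => t p) (pencil C D fun _ => t p) k p
        + dir (pencil A B t) t p * D k p - dir (pencil C D t) t p * B k p := by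
  have dt := differentiableAt_of_contDiffOn hU ht hp
  have d : ∀ {V : VField}, V.SmoothOn U → DifferentiableAt ℝ (V k) p :=
    fun hV => differentiableAt_of_contDiffOn hU (hV k) hp
  have e : ∀ (T V W : VField), V.SmoothOn U → W.SmoothOn U →
      dir T (pencil V W t k) p = dir T (V k) p + t p * dir T (W k) p + dir T t p * W k p := by
    intro T V W hV hW
    unfold pencil
    rw [dir_add T (d hV) (dt.fun_mul (d hW)), dir_mul T dt (d hW)]
    ring
  have e' : ∀ (T V W : VField), V.SmoothOn U → W.SmoothOn U →
      dir T (pencil V W (fun _ => t p) k) p = dir T (V k) p + t p * dir T (W k) p := by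
    intro T V W hV hW
    unfold pencil
    rw [dir_add T (d hV) ((differentiableAt_const _).fun_mul (d hW)),
      dir_mul T (differentiableAt_const _) (d hW)]
    simp [dir, pd_const]
  simp only [lie, e _ _ _ hA hB, e _ _ _ hC hD, e' _ _ _ hA hB, e' _ _ _ hC hD]
  simp only [dir_pencil]
  ring

/-- A polynomial with a prescribed quadratic Taylor expansion in two of the coordinates. -/
theorem exists_quadratic (p : R4) (i₀ j₀ : Fin 4) (t a b c d e : ℝ) :
    ∃ L : R4 → ℝ, ContDiff ℝ ∞ L ∧ L p = t ∧ ∀ i x, pd i L x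
      = (if i = i₀ then a + c * (x i₀ - p i₀) + d * (x j₀ - p j₀) else 0)
        + (if i = j₀ then b + d * (x i₀ - p i₀) + e * (x j₀ - p j₀) else 0) := by
  refine ⟨fun x => t + a * (x i₀ - p i₀) + b * (x j₀ - p j₀)
    + c / 2 * ((x i₀ - p i₀) * (x i₀ - p i₀)) + d * ((x i₀ - p i₀) * (x j₀ - p j₀))
    + e / 2 * ((x j₀ - p j₀) * (x j₀ - p j₀)), by fun_prop, by simp, fun i x => ?_⟩
  have du : ∀ (m : Fin 4), DifferentiableAt ℝ (fun x : R4 => x m - p m) x := fun m => by fun_prop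
  have pu : ∀ m, pd i (fun x : R4 => x m - p m) x = if i = m then 1 else 0 := fun m => by
    rw [pd_sub (by fun_prop) (by fun_prop), pd_coord, pd_const, sub_zero]
  have hm : ∀ (r : ℝ) {f : R4 → ℝ}, DifferentiableAt ℝ f x →
      pd i (fun y => r * f y) x = r * pd i f x := fun r f hf => by
    rw [pd_mul (differentiableAt_const _) hf, pd_const]; ring
  rw [pd_add (by fun_prop) (by fun_prop), pd_add (by fun_prop) (by fun_prop),
    pd_add (by fun_prop) (by fun_prop), pd_add (by fun_prop) (by fun_prop),
    pd_add (by fun_prop) (by fun_prop), hm _ (du _), hm _ (du _),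
    hm _ ((du _).fun_mul (du _)), hm _ ((du _).fun_mul (du _)), hm _ ((du _).fun_mul (du _)),
    pd_mul (du _) (du _), pd_mul (du _) (du _), pd_mul (du _) (du _), pu, pu, pd_const]
  split_ifs <;> ring

/-- Used to see that the null planes of the pencil contain their orthogonal vectors: the right side
vanishes when both vectors are orthogonal to `E₀ + λ E₁` and `E₂ + λ E₃`. -/
theorem IsMetricOn.bil_null_frame {g : MetricField} {U : Set R4} (hg : IsMetricOn g U)
    {p : R4} (hp : p ∈ U) {E : Fin 4 → VField} {s : ℝ}
    (H : IsNullFrame (g p) (Matrix.of fun a i => E a i p) s) (A B : VField) :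
    bil g A B p = s⁻¹ * (bil g A (E 0) p * bil g B (E 3) p + bil g A (E 3) p * bil g B (E 0) p
      - bil g A (E 1) p * bil g B (E 2) p - bil g A (E 2) p * bil g B (E 1) p) := by
  have e : ∀ V W : VField, bil g V W p = ∑ j, (∑ i, g p i j * V i p) * W j p := by
    intro V W
    unfold bil
    rw [Finset.sum_comm]
    exact Finset.sum_congr rfl fun j _ => by rw [Finset.sum_mul]
  have h1 : bil g A B p
      = ∑ k, ∑ l, (g p)⁻¹ k l * (∑ i, g p i k * A i p) * (∑ i, g p i l * B i p) := by
    have h2 : (g p).mulVec ((g p)⁻¹.mulVec ((g p).mulVec fun j => B j p))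
        = (g p).mulVec fun j => B j p := by
      rw [Matrix.mulVec_mulVec, hg.mul_inv hp, Matrix.one_mulVec]
    have h3 : (g p).mulVec (fun j => B j p) = fun l => ∑ i, g p i l * B i p := by
      ext l
      simp only [Matrix.mulVec, dotProduct, hg.comm hp l]
    have h4 : bil g A B p = dotProduct (fun i => A i p) ((g p).mulVec fun j => B j p) := by
      simp only [bil, Matrix.mulVec, dotProduct, Finset.mul_sum]
      exact Finset.sum_congr rfl fun i _ => Finset.sum_congr rfl fun j _ => by ring
    rw [h4, ← h2, Matrix.dotProduct_mulVec, h3]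
    simp only [Matrix.mulVec, dotProduct, Matrix.vecMul, Finset.mul_sum]
    refine Finset.sum_congr rfl fun k _ => Finset.sum_congr rfl fun l _ => ?_
    simp only [← Finset.mul_sum, mul_comm (g p _ k)]
    ring
  rw [h1]
  simp only [e _ (E _), H.inv_apply, Matrix.of_apply]
  simp only [Finset.sum_mul_sum, ← Finset.sum_add_distrib, ← Finset.sum_sub_distrib]
  simp only [Finset.mul_sum (a := s⁻¹)]
  refine Finset.sum_congr rfl fun k _ => Finset.sum_congr rfl fun l _ => ?_
  ring

/-! ### From commuting lifts to self-duality. -/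

namespace IsLaxFrame

variable {g : MetricField} {U : Set R4} {E : Fin 4 → VField} {s f₀ f₁ h₀ h₁ : R4 → ℝ}
  {i₀ j₀ : Fin 4} (F : IsLaxFrame g U E s f₀ f₁ h₀ h₁ i₀ j₀)
include F

theorem bil_frame {p : R4} (hp : p ∈ U) (a b : Fin 4) :
    bil g (E a) (E b) p = s p * nullGram a b := by
  have := (F.null p hp).gram_apply a b
  exact this

/-- The curvature vanishes on the planes spanned by a Lax pair. -/
theorem curv_eq_zero (hU : IsOpen U) (hg : IsMetricOn g U) {p : R4} (hp : p ∈ U) (t : ℝ) :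
    curv g p (fun i => E 0 i p + t * E 1 i p) (fun i => E 2 i p + t * E 3 i p)
      (fun i => E 0 i p + t * E 1 i p) (fun i => E 2 i p + t * E 3 i p) = 0 := by
  -- The 2-jet of `L` is forced: `a`, `b` are the prescribed values of `X L`, `Y L` at `p`, while
  -- `c`, `d`, `e` are the derivatives of those prescriptions along the lifted fields. The mixed
  -- coefficient `d` is taken as the `Y`-derivative of `f₀ + L f₁`.
  set a := f₀ p + t * f₁ p with ha
  set b := h₀ p + t * h₁ p with hb
  set c := dir (E 0) f₀ p + t * dir (E 1) f₀ p + t * (dir (E 0) f₁ p + t * dir (E 1) f₁ p)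
    + a * f₁ p with hc
  set d := dir (E 2) f₀ p + t * dir (E 3) f₀ p + t * (dir (E 2) f₁ p + t * dir (E 3) f₁ p)
    + b * f₁ p with hd
  set e := dir (E 2) h₀ p + t * dir (E 3) h₀ p + t * (dir (E 2) h₁ p + t * dir (E 3) h₁ p)
    + b * h₁ p with he
  obtain ⟨L, sL, Lp, pL⟩ := exists_quadratic p i₀ j₀ t a b c d e
  have sL' : ContDiffOn ℝ ∞ L U := sL.contDiffOn
  set X := pencil (E 0) (E 1) L with hX
  set Y := pencil (E 2) (E 3) L with hY
  have sX : X.SmoothOn U := smoothOn_pencil (F.smooth 0) (F.smooth 1) sL'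
  have sY : Y.SmoothOn U := smoothOn_pencil (F.smooth 2) (F.smooth 3) sL'
  have Xi : ∀ x ∈ U, X i₀ x = 1 := fun x hx => by
    obtain ⟨h0, h1, -, -⟩ := F.coord_i₀ x hx; simp [hX, pencil, h0, h1]
  have Xj : ∀ x ∈ U, X j₀ x = 0 := fun x hx => by
    obtain ⟨h0, h1, -, -⟩ := F.coord_j₀ x hx; simp [hX, pencil, h0, h1]
  have Yi : ∀ x ∈ U, Y i₀ x = 0 := fun x hx => by
    obtain ⟨-, -, h0, h1⟩ := F.coord_i₀ x hx; simp [hY, pencil, h0, h1]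
  have Yj : ∀ x ∈ U, Y j₀ x = 1 := fun x hx => by
    obtain ⟨-, -, h0, h1⟩ := F.coord_j₀ x hx; simp [hY, pencil, h0, h1]
  -- As `L` depends only on the coordinates `i₀` and `j₀`, in which `X` and `Y` have constant
  -- components `(1, 0)` and `(0, 1)`, they act on it as `∂_{i₀}` and `∂_{j₀}`.
  have XL : ∀ x ∈ U, dir X L x = a + c * (x i₀ - p i₀) + d * (x j₀ - p j₀) := fun x hx => by
    simp [dir, pL, mul_add, Finset.sum_add_distrib, Xi x hx, Xj x hx]
  have YL : ∀ x ∈ U, dir Y L x = b + d * (x i₀ - p i₀) + e * (x j₀ - p j₀) := fun x hx => by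
    simp [dir, pL, mul_add, Finset.sum_add_distrib, Yi x hx, Yj x hx]
  set u : R4 → ℝ := fun x => a + c * (x i₀ - p i₀) + d * (x j₀ - p j₀) - (f₀ x + L x * f₁ x)
    with hu
  set v : R4 → ℝ := fun x => b + d * (x i₀ - p i₀) + e * (x j₀ - p j₀) - (h₀ x + L x * h₁ x)
    with hv
  -- Here `u` and `v` are the errors with which `L` solves the system; they must vanish at `p`
  -- together with their derivatives along `X` and `Y`.
  have hlie : ∀ k, ∀ x ∈ U, lie X Y k x = u x * E 3 k x - v x * E 1 k x := by
    intro k x hx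
    rw [lie_pencil hU (F.smooth 0) (F.smooth 1) (F.smooth 2) (F.smooth 3) sL' hx,
      F.lie_eq x hx, ← hX, ← hY, XL x hx, YL x hx]
    ring
  have up : u p = 0 := by simp [hu, Lp, ha]
  have vp : v p = 0 := by simp [hv, Lp, hb]
  have df₀ := differentiableAt_of_contDiffOn hU F.smooth_f₀ hp
  have df₁ := differentiableAt_of_contDiffOn hU F.smooth_f₁ hp
  have dh₀ := differentiableAt_of_contDiffOn hU F.smooth_h₀ hp
  have dh₁ := differentiableAt_of_contDiffOn hU F.smooth_h₁ hp
  have dL := differentiableAt_of_contDiffOn hU sL' hp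
  have dE := fun a k => differentiableAt_of_contDiffOn hU (F.smooth a k) hp
  have hco : ∀ (T : VField) (m : Fin 4), dir T (fun x => x m) p = T m p := fun T m => by
    simp [dir, pd_coord]
  have hcst : ∀ (T : VField) (r : ℝ), dir T (fun _ => r) p = 0 := fun T r => by
    simp [dir, pd_const]
  have haff : ∀ (T : VField) (r r₁ r₂ : ℝ) (f f' : R4 → ℝ), DifferentiableAt ℝ f p →
      DifferentiableAt ℝ f' p → dir T (fun x => r + r₁ * (x i₀ - p i₀) + r₂ * (x j₀ - p j₀)
        - (f x + L x * f' x)) p = r₁ * T i₀ p + r₂ * T j₀ p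
        - (dir T f p + (dir T L p * f' p + t * dir T f' p)) := by
    intro T r r₁ r₂ f f' hf hf'
    rw [dir_sub T (by fun_prop) (by fun_prop), dir_add T hf (by fun_prop), dir_mul T dL hf',
      dir_add T (by fun_prop) (by fun_prop), dir_add T (by fun_prop) (by fun_prop),
      dir_mul T (by fun_prop) (by fun_prop), dir_mul T (by fun_prop) (by fun_prop),
      dir_sub T (by fun_prop) (by fun_prop), dir_sub T (by fun_prop) (by fun_prop)]
    simp only [hco, hcst, Lp]
    ring
  have hlift := F.lift p hp t
  have Xu : dir X u p = 0 := by
    rw [hu, haff X _ _ _ _ _ df₀ df₁, Xi p hp, Xj p hp, XL p hp, hX, dir_pencil, dir_pencil, Lp, hc]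
    ring
  have Yu : dir Y u p = 0 := by
    rw [hu, haff Y _ _ _ _ _ df₀ df₁, Yi p hp, Yj p hp, YL p hp, hY, dir_pencil, dir_pencil, Lp, hd]
    ring
  -- The only derivative that uses the lift condition: `d` must also equal the `X`-derivative of `h₀
  -- + L h₁`.
  have Xv : dir X v p = 0 := by
    rw [hv, haff X _ _ _ _ _ dh₀ dh₁, Xi p hp, Xj p hp, XL p hp, hX, dir_pencil, dir_pencil, Lp]
    linear_combination -hlift
  have Yv : dir Y v p = 0 := by
    rw [hv, haff Y _ _ _ _ _ dh₀ dh₁, Yi p hp, Yj p hp, YL p hp, hY, dir_pencil, dir_pencil, Lp, he]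
    ring
  have du : DifferentiableAt ℝ u p := by rw [hu]; fun_prop
  have dv : DifferentiableAt ℝ v p := by rw [hv]; fun_prop
  have dlie : ∀ T : VField, dir T u p = 0 → dir T v p = 0 → ∀ k, dir T (lie X Y k) p = 0 := by
    intro T h1 h2 k
    rw [dir_congr hU (hlie k) hp, dir_sub T (du.fun_mul (dE 3 k)) (dv.fun_mul (dE 1 k)),
      dir_mul T du (dE 3 k), dir_mul T dv (dE 1 k), h1, h2, up, vp]
    ring
  have bp : ∀ (V A B : VField) (x : R4), bil g V (pencil A B L) x
      = bil g V A x + L x * bil g V B x := by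
    intro V A B x
    simp only [bil, pencil, Finset.mul_sum, ← Finset.sum_add_distrib]
    exact Finset.sum_congr rfl fun i _ => Finset.sum_congr rfl fun j _ => by ring
  have bp' : ∀ (V A B : VField), ∀ x ∈ U, bil g (pencil A B L) V x
      = bil g A V x + L x * bil g B V x := by
    intro V A B x hx
    rw [hg.bil_comm hx, bp, hg.bil_comm hx V, hg.bil_comm hx V]
  have key := hg.curv_null_plane hU sX sY
    (fun x hx => by
      rw [hX, bp, bp' _ _ _ x hx, bp' _ _ _ x hx]; simp [F.bil_frame hx, nullGram])
    (fun x hx => by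
      rw [hX, hY, bp, bp' _ _ _ x hx, bp' _ _ _ x hx]; simp [F.bil_frame hx, nullGram])
    (fun x hx => by
      rw [hY, bp, bp' _ _ _ x hx, bp' _ _ _ x hx]; simp [F.bil_frame hx, nullGram])
    hp
    (fun A B h1 h2 h3 h4 => by
      rw [hX, bp] at h1 h3
      rw [hY, bp] at h2 h4
      rw [hg.bil_null_frame hp (F.null p hp) A B]
      linear_combination (s p)⁻¹ * (bil g B (E 3) p * h1 + bil g A (E 3) p * h3
        - bil g A (E 1) p * h4 - bil g B (E 1) p * h2))
    (fun k => by rw [hlie k p hp, up, vp]; ring) (dlie X Xu Xv) (dlie Y Yu Yv)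
  simpa only [hX, hY, pencil, Lp] using key

/-- A metric with a positively oriented Lax frame is self-dual. -/
theorem isSelfDualOn (hU : IsOpen U) (hs : ∀ i j, ContDiffOn ℝ ∞ (fun p => g p i j) U)
    (hsymm : ∀ p ∈ U, (g p).IsSymm) {η : R4 → ℝ} (hη : ContinuousOn η U)
    (hor : ∀ p ∈ U, 0 < η p * (Matrix.of fun a i => E a i p).det) : IsSelfDualOn g η U := by
  have hg : IsMetricOn g U := ⟨hs, hsymm, fun p hp => (F.null p hp).det_metric_ne_zero⟩
  refine ⟨hs, hsymm, hg.nondegenerate, hη, fun p hp h0 => ?_, fun p hp i j k l => ?_⟩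
  · have := hor p hp
    simp [h0] at this
  · exact hodgeStar_weyl_eq hg hU hp (F.null p hp) (hor p hp)
      (fun t => F.curv_eq_zero hU hg hp t) i j k l

end IsLaxFrame

/-! ### The three families of metrics -/

/-- Separates a bracket condition into its coefficients in `λ`. -/
theorem lie_pencil_const {U : Set R4} (hU : IsOpen U) {A B C D : VField} (hA : A.SmoothOn U)
    (hB : B.SmoothOn U) (hC : C.SmoothOn U) (hD : D.SmoothOn U) (t : ℝ) {p : R4} (hp : p ∈ U)
    (k : Fin 4) :
    lie (pencil A B fun _ => t) (pencil C D fun _ => t) k p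
      = lie A C k p + t * (lie A D k p + lie B C k p) + t ^ 2 * lie B D k p := by
  have d : ∀ {V : VField}, V.SmoothOn U → DifferentiableAt ℝ (V k) p :=
    fun hV => differentiableAt_of_contDiffOn hU (hV k) hp
  have e : ∀ (T V W : VField), V.SmoothOn U → W.SmoothOn U →
      dir T (pencil V W (fun _ => t) k) p = dir T (V k) p + t * dir T (W k) p := by
    intro T V W hV hW
    unfold pencil
    rw [dir_add T (d hV) ((differentiableAt_const _).fun_mul (d hW)),
      dir_mul T (differentiableAt_const _) (d hW)]
    simp [dir, pd_const]
  simp only [lie, e _ _ _ hA hB, e _ _ _ hC hD, dir_pencil]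
  ring

theorem dir_neg (T : VField) (f : R4 → ℝ) (p : R4) : dir T (fun x => -f x) p = -dir T f p := by
  simp only [dir, pd_neg, mul_neg, Finset.sum_neg_distrib]

theorem dir_zero (T : VField) (p : R4) : dir T (fun _ => 0) p = 0 := by
  simp [dir, pd_const]

/-- The second-order terms cancel because mixed partial derivatives of `f` commute. -/
theorem dir_lie {U : Set R4} (hU : IsOpen U) {X Y : VField} (hX : X.SmoothOn U)
    (hY : Y.SmoothOn U) {f : R4 → ℝ} (hf : ContDiffOn ℝ ∞ f U) {p : R4} (hp : p ∈ U) :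
    dir X (dir Y f) p - dir Y (dir X f) p = dir (lie X Y) f p := by
  have df := fun i => differentiableAt_of_contDiffOn hU (contDiffOn_pd hU hf i) hp
  have e : ∀ {V : VField}, V.SmoothOn U → ∀ i, pd i (dir V f) p
      = ∑ j, (pd i (V j) p * pd j f p + V j p * pd i (pd j f) p) := by
    intro V hV i
    have dV := fun j => differentiableAt_of_contDiffOn hU (hV j) hp
    unfold dir
    rw [pd_sum fun j _ => (dV j).fun_mul (df j)]
    exact Finset.sum_congr rfl fun j _ => pd_mul (dV j) (df j) i
  have hs : ∑ i, ∑ j, X i p * (Y j p * pd i (pd j f) p)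
      = ∑ i, ∑ j, Y i p * (X j p * pd i (pd j f) p) := by
    rw [Finset.sum_comm]
    refine Finset.sum_congr rfl fun i _ => Finset.sum_congr rfl fun j _ => ?_
    rw [pd_comm hU hf hp]; ring
  have e' : ∀ {V W : VField}, W.SmoothOn U → dir V (dir W f) p
      = ∑ j, dir V (W j) p * pd j f p + ∑ i, ∑ j, V i p * (W j p * pd i (pd j f) p) := by
    intro V W hW
    rw [dir]
    simp only [e hW, Finset.sum_add_distrib, Finset.mul_sum, mul_add, dir, Finset.sum_mul]
    congr 1
    rw [Finset.sum_comm]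
    exact Finset.sum_congr rfl fun j _ => Finset.sum_congr rfl fun i _ => by ring
  rw [e' hY, e' hX, hs, dir]
  simp only [lie, sub_mul, Finset.sum_sub_distrib]
  ring

theorem metricSix_eq (a b c d q r : R4 → ℝ) (p : R4) : metricSix a b c d q r p
    = !![0, -((q p - r p) * (a p * d p - b p * c p)) / 2, -a p / 2, b p / 2;
      -((q p - r p) * (a p * d p - b p * c p)) / 2, 0, -c p / 2, d p / 2;
      -a p / 2, -c p / 2, 0, 0; b p / 2, d p / 2, 0, 0] := by
  ext i j
  fin_cases i <;> fin_cases j <;> simp [metricSix, symProd] <;> ring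

theorem metricSecond_eq (v w : R4 → ℝ) (p : R4) : metricSecond v w p
    = !![0, 0, 1 / 2, 0; 0, 0, 0, 1 / 2; 1 / 2, 0, -pdy v p, (pdx v p + pdy w p) / 2;
      0, 1 / 2, (pdx v p + pdy w p) / 2, -pdx w p] := by
  ext i j
  fin_cases i <;> fin_cases j <;> simp [metricSecond, symProd] <;> ring

theorem metricFirst_eq (v w : R4 → ℝ) (p : R4) : metricFirst v w p
    = !![0, 0, -pdx v p / 2, pdx w p / 2; 0, 0, -pdy v p / 2, pdy w p / 2;
      -pdx v p / 2, -pdy v p / 2, 0, 0; pdx w p / 2, pdy w p / 2, 0, 0] := by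
  ext i j
  fin_cases i <;> fin_cases j <;> simp [metricFirst, symProd] <;> ring

/-! ### The six-component family. -/

section Six

variable {U : Set R4} {a b c d q r : R4 → ℝ}

/-- The frame of the Lax pair `∂_x + (λ + q)(a ∂_t + b ∂_z)`, `∂_y + (λ + r)(c ∂_t + d ∂_z)`. -/
def frameSix (a b c d q r : R4 → ℝ) : Fin 4 → VField :=
  ![![fun _ => 1, fun _ => 0, fun x => b x * q x, fun x => a x * q x],
    ![fun _ => 0, fun _ => 0, b, a],
    ![fun _ => 0, fun _ => 1, fun x => d x * r x, fun x => c x * r x],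
    ![fun _ => 0, fun _ => 0, d, c]]

/-- The pair commutes for every constant `λ`, so the lift has no `∂_λ` part and its condition is
empty. -/
theorem isLaxFrame_six (hU : IsOpen U) (ha : ContDiffOn ℝ ∞ a U) (hb : ContDiffOn ℝ ∞ b U)
    (hc : ContDiffOn ℝ ∞ c U) (hd : ContDiffOn ℝ ∞ d U) (hq : ContDiffOn ℝ ∞ q U)
    (hr : ContDiffOn ℝ ∞ r U) (hD : ∀ p ∈ U, a p * d p - b p * c p ≠ 0)
    (h : SolvesSix a b c d q r U) :
    IsLaxFrame (metricSix a b c d q r) U (frameSix a b c d q r)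
      (fun p => -(a p * d p - b p * c p) / 2) (fun _ => 0) (fun _ => 0) (fun _ => 0) (fun _ => 0)
      0 1 := by
  have hs : ∀ e, (frameSix a b c d q r e).SmoothOn U := by
    intro e k
    fin_cases e <;> fin_cases k <;>
      first
      | exact contDiffOn_const | assumption | exact ContDiffOn.mul (by assumption) (by assumption)
  refine ⟨hs, contDiffOn_const, contDiffOn_const, contDiffOn_const, contDiffOn_const,
    fun p hp => ⟨?_, ?_⟩, fun p hp => by simp [frameSix], fun p hp => by simp [frameSix],
    fun p hp t k => ?_, fun p hp t => by simp [dir, pd_const]⟩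
  · exact div_ne_zero (neg_ne_zero.2 (hD p hp)) two_ne_zero
  · rw [metricSix_eq]
    ext i j
    fin_cases i <;> fin_cases j <;>
      simp [frameSix, nullGram, Matrix.mul_apply, Fin.sum_univ_four] <;> ring
  · rw [lie_pencil_const hU (hs 0) (hs 1) (hs 2) (hs 3) t hp]
    have da := differentiableAt_of_contDiffOn hU ha hp
    have db := differentiableAt_of_contDiffOn hU hb hp
    have dc := differentiableAt_of_contDiffOn hU hc hp
    have dd := differentiableAt_of_contDiffOn hU hd hp
    have dq := differentiableAt_of_contDiffOn hU hq hp
    have dr := differentiableAt_of_contDiffOn hU hr hp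
    have e1 := h.eq1 p hp
    have e2 := h.eq2 p hp
    have e3 := h.eq3 p hp
    have e4 := h.eq4 p hp
    have e5 := h.eq5 p hp
    have e6 := h.eq6 p hp
    have m1 : ∀ i, pd i (b * q) p = pd i b p * q p + b p * pd i q p := pd_mul db dq
    have m2 : ∀ i, pd i (a * q) p = pd i a p * q p + a p * pd i q p := pd_mul da dq
    have m3 : ∀ i, pd i (d * r) p = pd i d p * r p + d p * pd i r p := pd_mul dd dr
    have m4 : ∀ i, pd i (c * r) p = pd i c p * r p + c p * pd i r p := pd_mul dc dr
    have m5 : ∀ i, pd i (r - q) p = pd i r p - pd i q p := pd_sub dr dq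
    simp only [Pi.add_apply, Pi.sub_apply, Pi.mul_apply, m1, m2, m3, m4, m5] at e1 e2 e3 e4 e5 e6
    have n1 := pd_mul db dq
    have n2 := pd_mul da dq
    have n3 := pd_mul dd dr
    have n4 := pd_mul dc dr
    fin_cases k <;>
      simp [lie, dir, frameSix, Fin.sum_univ_four, pd_const, n1, n2, n3, n4]
    -- The `∂_z` component of the bracket; the next goal is the `∂_t` component.
    · linear_combination e3 + t * e6 + t ^ 2 * e2
    · linear_combination e4 + t * e5 + t ^ 2 * e1

theorem isSelfDualOn_metricSix (hU : IsOpen U) (ha : ContDiffOn ℝ ∞ a U) (hb : ContDiffOn ℝ ∞ b U)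
    (hc : ContDiffOn ℝ ∞ c U) (hd : ContDiffOn ℝ ∞ d U) (hq : ContDiffOn ℝ ∞ q U)
    (hr : ContDiffOn ℝ ∞ r U) (hD : ∀ p ∈ U, a p * d p - b p * c p ≠ 0)
    (h : SolvesSix a b c d q r U) :
    IsSelfDualOn (metricSix a b c d q r) (fun p => a p * d p - b p * c p) U := by
  refine (isLaxFrame_six hU ha hb hc hd hq hr hD h).isSelfDualOn hU (fun i j => ?_)
    (fun p hp => ?_) ((ha.mul hd).sub (hb.mul hc)).continuousOn fun p hp => ?_
  · simp only [metricSix, Matrix.add_apply, Matrix.sub_apply, Matrix.smul_apply, smul_eq_mul]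
    fun_prop
  · rw [metricSix_eq]
    ext i j
    fin_cases i <;> fin_cases j <;> rfl
  · have : (Matrix.of fun e i => frameSix a b c d q r e i p).det = a p * d p - b p * c p := by
      simp [det_four, frameSix]; ring
    rw [this]
    exact mul_self_pos.2 (hD p hp)

end Six

/-! ### The generalized second heavenly system. -/

section Second

variable {U : Set R4} {u v w : R4 → ℝ}

/-- The frame of the Lax pair `∂_z + v_y ∂_x - w_y ∂_y + λ ∂_y`, `∂_t - v_x ∂_x + w_x ∂_y - λ ∂_x`. -/
def frameSecond (v w : R4 → ℝ) : Fin 4 → VField :=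
  ![![pdy v, fun x => -pdy w x, fun _ => 1, fun _ => 0],
    ![fun _ => 0, fun _ => 1, fun _ => 0, fun _ => 0],
    ![fun x => -pdx v x, pdx w, fun _ => 0, fun _ => 1],
    ![fun _ => -1, fun _ => 0, fun _ => 0, fun _ => 0]]

/-- The lifts are `X + u_y ∂_λ` and `Y - u_x ∂_λ`. The equations for `v` and `w` are the `∂_x` and
`∂_y` components of the bracket condition, and the equation for `u` is the lift condition; the terms
in `λ` cancel by symmetry of mixed partials. -/
theorem isLaxFrame_second (hU : IsOpen U) (hu : ContDiffOn ℝ ∞ u U) (hv : ContDiffOn ℝ ∞ v U)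
    (hw : ContDiffOn ℝ ∞ w U) (h : SolvesSecond u v w U) :
    IsLaxFrame (metricSecond v w) U (frameSecond v w) (fun _ => -1 / 2)
      (pdy u) (fun _ => 0) (fun x => -pdx u x) (fun _ => 0) 2 3 := by
  have hs : ∀ e, (frameSecond v w e).SmoothOn U := by
    intro e k
    fin_cases e <;> fin_cases k <;>
      first
      | exact contDiffOn_const
      | exact contDiffOn_pd hU (by assumption) _
      | exact (contDiffOn_pd hU (by assumption) _).neg
  refine ⟨hs, contDiffOn_pd hU hu 1, contDiffOn_const, (contDiffOn_pd hU hu 0).neg,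
    contDiffOn_const, fun p hp => ⟨by norm_num, ?_⟩, fun p hp => by simp [frameSecond],
    fun p hp => by simp [frameSecond], fun p hp t k => ?_, fun p hp t => ?_⟩
  · rw [metricSecond_eq]
    ext i j
    fin_cases i <;> fin_cases j <;>
      simp [frameSecond, nullGram, Matrix.mul_apply, Fin.sum_univ_four] <;> ring
  · rw [lie_pencil_const hU (hs 0) (hs 1) (hs 2) (hs 3) t hp]
    have e2 := h.eq2 p hp
    have e3 := h.eq3 p hp
    simp only [Pi.add_apply, Pi.sub_apply, Pi.mul_apply, pdx, pdy, pdz, pdt] at e2 e3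
    have cv := pd_comm hU hv hp
    have cw := pd_comm hU hw hp
    rw [cv 1 3, cv 1 0] at e2
    rw [cw 1 3, cw 1 0] at e3
    fin_cases k <;>
      simp [lie, dir, frameSecond, Fin.sum_univ_four, pd_const, pd_neg, pdx, pdy]
    · linear_combination -e2 + (pd 1 w p - t) * cv 1 0
    · linear_combination e3 + (t - pd 1 w p) * cw 1 0
  · have e1 := h.eq1 p hp
    simp only [Pi.add_apply, Pi.sub_apply, Pi.mul_apply, pdx, pdy, pdz, pdt] at e1
    have cu := pd_comm hU hu hp
    rw [cu 1 3, cu 1 0] at e1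
    simp [dir, frameSecond, Fin.sum_univ_four, pd_const, pd_neg, pdx, pdy]
    linear_combination -e1 + (pd 1 w p - t) * cu 1 0

theorem isSelfDualOn_metricSecond (hU : IsOpen U) (hu : ContDiffOn ℝ ∞ u U)
    (hv : ContDiffOn ℝ ∞ v U) (hw : ContDiffOn ℝ ∞ w U) (h : SolvesSecond u v w U) :
    IsSelfDualOn (metricSecond v w) (fun _ => -1) U := by
  have hvx := contDiffOn_pd hU hv 0
  have hvy := contDiffOn_pd hU hv 1
  have hwx := contDiffOn_pd hU hw 0
  have hwy := contDiffOn_pd hU hw 1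
  refine (isLaxFrame_second hU hu hv hw h).isSelfDualOn hU (fun i j => ?_)
    (fun p hp => ?_) continuousOn_const fun p hp => ?_
  · simp only [metricSecond, Matrix.add_apply, Matrix.sub_apply, Matrix.smul_apply, smul_eq_mul]
    fun_prop
  · rw [metricSecond_eq]
    ext i j
    fin_cases i <;> fin_cases j <;> rfl
  · have : (Matrix.of fun e i => frameSecond v w e i p).det = -1 := by
      simp [det_four, frameSecond]
    rw [this]
    norm_num

end Second

/-! ### The generalized first heavenly system. -/

section First

variable {U : Set R4} {u v w : R4 → ℝ}

/-- `1 / (v_x w_y - v_y w_x)`. -/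
def invJac (v w : R4 → ℝ) : R4 → ℝ := fun x => (pdx v x * pdy w x - pdy v x * pdx w x)⁻¹

/-- The frame of the Lax pair `∂_z + λ (v_y ∂_x - v_x ∂_y) / (v_x w_y - v_y w_x)`,
`∂_t + λ (w_x ∂_y - w_y ∂_x) / (v_x w_y - v_y w_x)`. -/
def frameFirst (v w : R4 → ℝ) : Fin 4 → VField :=
  ![![fun _ => 0, fun _ => 0, fun _ => 1, fun _ => 0],
    ![fun x => invJac v w x * pdy v x, fun x => -(invJac v w x * pdx v x), fun _ => 0, fun _ => 0],
    ![fun _ => 0, fun _ => 0, fun _ => 0, fun _ => 1],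
    ![fun x => -(invJac v w x * pdy w x), fun x => invJac v w x * pdx w x, fun _ => 0, fun _ => 0]]

theorem contDiffOn_invJac (hU : IsOpen U) (hv : ContDiffOn ℝ ∞ v U) (hw : ContDiffOn ℝ ∞ w U)
    (hD : ∀ p ∈ U, pdx v p * pdy w p - pdy v p * pdx w p ≠ 0) : ContDiffOn ℝ ∞ (invJac v w) U :=
  (((contDiffOn_pd hU hv 0).mul (contDiffOn_pd hU hw 1)).sub
    ((contDiffOn_pd hU hv 1).mul (contDiffOn_pd hU hw 0))).inv hD

theorem invJac_mul {p : R4} (hD : pdx v p * pdy w p - pdy v p * pdx w p ≠ 0) :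
    invJac v w p * (pdx v p * pdy w p - pdy v p * pdx w p) = 1 := inv_mul_cancel₀ hD

/-- Obtained by differentiating the product of `invJac v w` with the Jacobian, which is constantly
one on `U`. -/
theorem pd_invJac (hU : IsOpen U) (hv : ContDiffOn ℝ ∞ v U) (hw : ContDiffOn ℝ ∞ w U)
    (hD : ∀ p ∈ U, pdx v p * pdy w p - pdy v p * pdx w p ≠ 0) {p : R4} (hp : p ∈ U) (i : Fin 4) :
    pd i (invJac v w) p = -(invJac v w p) ^ 2 *
      (pd i (pdx v) p * pdy w p + pdx v p * pd i (pdy w) p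
        - (pd i (pdy v) p * pdx w p + pdy v p * pd i (pdx w) p)) := by
  have dv := fun i => differentiableAt_of_contDiffOn hU (contDiffOn_pd hU hv i) hp
  have dw := fun i => differentiableAt_of_contDiffOn hU (contDiffOn_pd hU hw i) hp
  have dm := differentiableAt_of_contDiffOn hU (contDiffOn_invJac hU hv hw hD) hp
  have h1 : pd i (fun x => invJac v w x * (pdx v x * pdy w x - pdy v x * pdx w x)) p = 0 := by
    rw [pd_congr hU (fun x hx => invJac_mul (hD x hx)) hp, pd_const]
  rw [pd_mul dm (((dv 0).fun_mul (dw 1)).fun_sub ((dv 1).fun_mul (dw 0))),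
    pd_sub ((dv 0).fun_mul (dw 1)) ((dv 1).fun_mul (dw 0)), pd_mul (dv 0) (dw 1),
    pd_mul (dv 1) (dw 0)] at h1
  linear_combination invJac v w p * h1 - pd i (invJac v w) p * invJac_mul (hD p hp)

/-- The brackets of the frame fields along the coordinate `λ`. -/
theorem lie_frameFirst (hU : IsOpen U) (hv : ContDiffOn ℝ ∞ v U) (hw : ContDiffOn ℝ ∞ w U)
    (hD : ∀ p ∈ U, pdx v p * pdy w p - pdy v p * pdx w p ≠ 0) (h : SolvesFirst u v w U)
    {p : R4} (hp : p ∈ U) (k : Fin 4) :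
    lie (frameFirst v w 0) (frameFirst v w 3) k p + lie (frameFirst v w 1) (frameFirst v w 2) k p
        = -dir (frameFirst v w 3) u p * frameFirst v w 1 k p
          + dir (frameFirst v w 1) u p * frameFirst v w 3 k p ∧
      lie (frameFirst v w 1) (frameFirst v w 3) k p = 0 := by
  have dv := fun i => differentiableAt_of_contDiffOn hU (contDiffOn_pd hU hv i) hp
  have dw := fun i => differentiableAt_of_contDiffOn hU (contDiffOn_pd hU hw i) hp
  have dm := differentiableAt_of_contDiffOn hU (contDiffOn_invJac hU hv hw hD) hp
  have pm := pd_invJac hU hv hw hD hp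
  have hm := invJac_mul (hD p hp)
  have e2 := h.eq2 p hp
  have e3 := h.eq3 p hp
  simp only [Pi.add_apply, Pi.sub_apply, Pi.mul_apply, pdx, pdy, pdz, pdt] at e2 e3
  have cv := pd_comm hU hv hp
  have cw := pd_comm hU hw hp
  rw [cv 0 3, cv 1 3] at e2
  rw [cw 0 3, cw 1 3] at e3
  have n1 := fun i => pd_mul dm (dv i)
  have n2 := fun i => pd_mul dm (dw i)
  simp only [pdx, pdy] at pm hm
  -- The second conjunct holds without the equations: in each `(x, y)`-plane `E₁` and `E₃` are
  -- `-∂_w` and `-∂_v` for the local coordinates `(v, w)`, so they commute. The first is where the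
  -- equations for `v` and `w` enter.
  fin_cases k <;>
    simp [lie, dir, frameFirst, Fin.sum_univ_four, pd_const, pd_neg, n1, n2, pm, pdx, pdy,
      cv 1 0, cw 1 0] <;>
    constructor
  · linear_combination (invJac v w p) ^ 2 * (pd 1 v p * e3 - pd 1 w p * e2)
      + invJac v w p * (pd 2 (pd 1 w) p + pd 3 (pd 1 v) p) * hm
  · linear_combination -(invJac v w p) ^ 2 * (pd 0 (pd 1 v) p * pd 1 w p
      + pd 0 v p * pd 1 (pd 1 w) p - pd 1 (pd 1 v) p * pd 0 w p
      - pd 1 v p * pd 0 (pd 1 w) p) * hm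
  · linear_combination (invJac v w p) ^ 2 * (pd 0 w p * e2 - pd 0 v p * e3)
      - invJac v w p * (pd 2 (pd 0 w) p + pd 3 (pd 0 v) p) * hm
  · linear_combination (invJac v w p) ^ 2 * (pd 0 (pd 0 v) p * pd 1 w p
      + pd 0 v p * pd 0 (pd 1 w) p - pd 0 (pd 1 v) p * pd 0 w p
      - pd 1 v p * pd 0 (pd 0 w) p) * hm

/-- The lifts are `X - λ E₁(u) ∂_λ` and `Y - λ E₃(u) ∂_λ`. The lift condition amounts to `E₀ E₃ u =
E₂ E₁ u` and `E₁ E₃ u = E₃ E₁ u`; the second follows from `[E₁, E₃] = 0`. -/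
theorem isLaxFrame_first (hU : IsOpen U) (hu : ContDiffOn ℝ ∞ u U) (hv : ContDiffOn ℝ ∞ v U)
    (hw : ContDiffOn ℝ ∞ w U) (hD : ∀ p ∈ U, pdx v p * pdy w p - pdy v p * pdx w p ≠ 0)
    (h : SolvesFirst u v w U) :
    IsLaxFrame (metricFirst v w) U (frameFirst v w) (fun _ => 1 / 2)
      (fun _ => 0) (fun x => -dir (frameFirst v w 1) u x)
      (fun _ => 0) (fun x => -dir (frameFirst v w 3) u x) 2 3 := by
  have hm := contDiffOn_invJac hU hv hw hD
  have hs : ∀ e, (frameFirst v w e).SmoothOn U := by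
    intro e k
    fin_cases e <;> fin_cases k <;>
      first
      | exact contDiffOn_const
      | exact hm.mul (contDiffOn_pd hU (by assumption) _)
      | exact (hm.mul (contDiffOn_pd hU (by assumption) _)).neg
  refine ⟨hs, contDiffOn_const, (contDiffOn_dir hU (hs 1) hu).neg, contDiffOn_const,
    (contDiffOn_dir hU (hs 3) hu).neg, fun p hp => ⟨by norm_num, ?_⟩,
    fun p hp => by simp [frameFirst], fun p hp => by simp [frameFirst], fun p hp t k => ?_,
    fun p hp t => ?_⟩
  · have hm := invJac_mul (hD p hp)
    rw [metricFirst_eq]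
    ext i j
    fin_cases i <;> fin_cases j <;>
      simp [frameFirst, nullGram, Matrix.mul_apply, Fin.sum_univ_four] <;> linarith
  · obtain ⟨l1, l2⟩ := lie_frameFirst hU hv hw hD h hp k
    have l0 : lie (frameFirst v w 0) (frameFirst v w 2) k p = 0 := by
      fin_cases k <;> simp [lie, dir, frameFirst, pd_const]
    rw [lie_pencil_const hU (hs 0) (hs 1) (hs 2) (hs 3) t hp, l0, l1, l2]
    ring
  · have l := lie_frameFirst hU hv hw hD h hp
    have c03 := dir_lie hU (hs 0) (hs 3) hu hp
    have c12 := dir_lie hU (hs 1) (hs 2) hu hp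
    have c13 := dir_lie hU (hs 1) (hs 3) hu hp
    have z13 : dir (lie (frameFirst v w 1) (frameFirst v w 3)) u p = 0 := by
      simp only [dir, (l _).2, zero_mul, Finset.sum_const_zero]
    -- Applied to `u`, the bracket relation `[E₀, E₃] + [E₁, E₂] = -E₃(u) E₁ + E₁(u) E₃` gives zero.
    -- Hence `E₀ E₃ u - E₂ E₁ u = E₃ E₀ u - E₁ E₂ u`, and `hx` identifies the right side with the
    -- equation for `u` divided by the Jacobian.
    have zsum : dir (lie (frameFirst v w 0) (frameFirst v w 3)) u p
        + dir (lie (frameFirst v w 1) (frameFirst v w 2)) u p = 0 := by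
      have e : dir (lie (frameFirst v w 0) (frameFirst v w 3)) u p
          + dir (lie (frameFirst v w 1) (frameFirst v w 2)) u p
          = -dir (frameFirst v w 3) u p * dir (frameFirst v w 1) u p
            + dir (frameFirst v w 1) u p * dir (frameFirst v w 3) u p := by
        conv_lhs => simp only [dir, ← Finset.sum_add_distrib, ← add_mul, (l _).1]
        conv_rhs => rw [dir.eq_def (frameFirst v w 1) u, dir.eq_def (frameFirst v w 3) u]
        simp only [add_mul, Finset.sum_add_distrib, Finset.mul_sum, mul_assoc]
      rw [e]; ring
    have e0 : dir (frameFirst v w 0) u = pd 2 u := by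
      ext x; simp [dir, frameFirst, Fin.sum_univ_four]
    have e2 : dir (frameFirst v w 2) u = pd 3 u := by
      ext x; simp [dir, frameFirst, Fin.sum_univ_four]
    have e1 := h.eq1 p hp
    have cu := pd_comm hU hu hp
    simp only [Pi.add_apply, Pi.sub_apply, Pi.mul_apply, pdx, pdy, pdz, pdt] at e1
    rw [cu 2 1, cu 2 0] at e1
    have hx : dir (frameFirst v w 3) (pd 2 u) p - dir (frameFirst v w 1) (pd 3 u) p = 0 := by
      simp [dir, frameFirst, Fin.sum_univ_four, pdx, pdy]
      linear_combination invJac v w p * e1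
    rw [e0] at c03
    rw [e2] at c12
    simp only [dir_neg, dir_zero]
    linear_combination -t * (c03 + c12 + zsum + hx) - t ^ 2 * (c13 + z13)

theorem isSelfDualOn_metricFirst (hU : IsOpen U) (hu : ContDiffOn ℝ ∞ u U)
    (hv : ContDiffOn ℝ ∞ v U) (hw : ContDiffOn ℝ ∞ w U)
    (hD : ∀ p ∈ U, pdx v p * pdy w p - pdy v p * pdx w p ≠ 0) (h : SolvesFirst u v w U) :
    IsSelfDualOn (metricFirst v w) (fun p => pdx v p * pdy w p - pdy v p * pdx w p) U := by
  have hvx := contDiffOn_pd hU hv 0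
  have hvy := contDiffOn_pd hU hv 1
  have hwx := contDiffOn_pd hU hw 0
  have hwy := contDiffOn_pd hU hw 1
  refine (isLaxFrame_first hU hu hv hw hD h).isSelfDualOn hU (fun i j => ?_)
    (fun p hp => ?_) ((hvx.mul hwy).sub (hvy.mul hwx)).continuousOn fun p hp => ?_
  · simp only [metricFirst, Matrix.add_apply, Matrix.sub_apply, Matrix.smul_apply, smul_eq_mul]
    fun_prop
  · rw [metricFirst_eq]
    ext i j
    fin_cases i <;> fin_cases j <;> rfl
  · have hm := invJac_mul (hD p hp)
    have : (Matrix.of fun e i => frameFirst v w e i p).det = invJac v w p := by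
      simp [det_four, frameFirst]
      linear_combination invJac v w p * hm
    rw [this, mul_comm, hm]
    exact one_pos

end First

end SelfDual4D

end

theorem mainTheorem6 (U : Set SelfDual4D.R4) (hU : IsOpen U) :
    (∀ a b c d q r : SelfDual4D.R4 → ℝ,
      ContDiffOn ℝ ∞ a U → ContDiffOn ℝ ∞ b U → ContDiffOn ℝ ∞ c U →
      ContDiffOn ℝ ∞ d U → ContDiffOn ℝ ∞ q U → ContDiffOn ℝ ∞ r U →
      (∀ p ∈ U, a p * d p - b p * c p ≠ 0) →
      SelfDual4D.SolvesSix a b c d q r U →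
      SelfDual4D.IsSelfDualOn (SelfDual4D.metricSix a b c d q r)
        (fun p => a p * d p - b p * c p) U) ∧
    (∀ u v w : SelfDual4D.R4 → ℝ,
      ContDiffOn ℝ ∞ u U → ContDiffOn ℝ ∞ v U → ContDiffOn ℝ ∞ w U →
      SelfDual4D.SolvesSecond u v w U →
      SelfDual4D.IsSelfDualOn (SelfDual4D.metricSecond v w) (fun _ => -1) U) ∧
    (∀ u v w : SelfDual4D.R4 → ℝ,
      ContDiffOn ℝ ∞ u U → ContDiffOn ℝ ∞ v U → ContDiffOn ℝ ∞ w U →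
      (∀ p ∈ U, SelfDual4D.pdx v p * SelfDual4D.pdy w p
        - SelfDual4D.pdy v p * SelfDual4D.pdx w p ≠ 0) →
      SelfDual4D.SolvesFirst u v w U →
      SelfDual4D.IsSelfDualOn (SelfDual4D.metricFirst v w)
        (fun p => SelfDual4D.pdx v p * SelfDual4D.pdy w p
          - SelfDual4D.pdy v p * SelfDual4D.pdx w p) U) := by
  exact ⟨fun _ _ _ _ _ _ ha hb hc hd hq hr hD h =>
      SelfDual4D.isSelfDualOn_metricSix hU ha hb hc hd hq hr hD h,
    fun _ _ _ hu hv hw h => SelfDual4D.isSelfDualOn_metricSecond hU hu hv hw h,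
    fun _ _ _ hu hv hw hD h => SelfDual4D.isSelfDualOn_metricFirst hU hu hv hw hD h⟩
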